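/- **Topological recursion.** Let a curve with a global coordinate $z$ be given, together with functions $x,y$ on it ($y$ may be multivalued), a finite set $\mathcal P$ of simple critical points of $x$ at which $dy\ne 0$, and a symmetric bidifferential $B(z_1,z_2)$. Near $\xi\in\mathcal P$ let $\sigma_\xi$ be the non-trivial local holomorphic involution with $x\circ\sigma_\xi=x$, and use there one holomorphic branch of $y$. Put $\omega_{0,2}=B$ and, for $g\ge 0$, $n\ge1$, $2g-2+n>0$, $$\omega_{g,n}(z_1,\dots,z_n)=\frac12\sum_{\xi\in\mathcal P}\operatorname*{Res}_{z\to\xi}\frac{\int_z^{\sigma_\xi(z)}B(z_1,\cdot)}{\bigl(y(\sigma_\xi(z))-y(z)\bigr)\,dx(z)}\Bigl(\omega_{g-1,n+1}(z,\sigma_\xi(z),z_2,\dots,z_n)+\sum_{\substack{g_1+g_2=g,\ I_1\sqcup I_2=\{2,\dots,n\}\\ (g_1,|I_1|),(g_2,|I_2|)\neq(0,0)}}\omega_{g_1,1+|I_1|}(z,z_{I_1})\,\omega_{g_2,1+|I_2|}(\sigma_\xi(z),z_{I_2})\Bigr),$$ where $\int_z^{\sigma_\xi(z)}$ is taken along a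 path near $\xi$ and $\omega_{-1,n+1}=0$. For ordinary topological recursion $\omega_{0,1}=y\,dx$; for $G$-equivariant topological recursion ($G$ a finite group acting on the curve, with $dx$, $dy$, $B$ equivariant under characters of $G$ and $B$ having the singular part of $\sum_{\eta\in G}\beta_\eta^{-1}\frac{d(\eta z_1)\,dz_2}{(\eta z_1-z_2)^2}$, where $\beta$ is the character of $B$) the same recursion is used and $\omega_{0,1}=|G|^{-1}y\,dx$. **Proposition.** Let $\epsilon\in\mathbb C\setminus\{0\}$ and fix square roots $\sqrt{\epsilon/2}$ and $\sqrt{2\epsilon}$ (any choice). Let $\tilde\omega_{g,n}$ be the differentials of topological recursion on the rational curve with coordinate $w$, $$\tilde x=\frac{w^2}{2},\qquad \tilde y=\frac{2\,\mathrm{arcsinh}(w/\sqrt{2\epsilon})}{\sqrt{w^2+2\epsilon}},\qquad \tilde B=\frac{dw_1\,dw_2}{(w_1-w_2)^2},\qquad \mathcal P=\{0\},$$ where near $w=0$ the branches are those with $\mathrm{arcsinh}(0)=0$ and $\sqrt{w^2+2\epsilon}\,|_{w=0}=\sqrt{2\epsilon}$. Let $\omega_{g,n}$ be the differentials of $\mathbb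 Z_2$-equivariant topological recursion on the rational curve with coordinate $z$, $\mathbb Z_2$ acting by $\iota(z)=-1/z$, $$x=\sqrt{\epsilon/2}\,\Bigl(z+\frac1z\Bigr),\qquad y=2\log z,\qquad B=\frac{dz_1\,dz_2}{(z_1-z_2)^2}+\frac{d\iota(z_1)\,dz_2}{(\iota(z_1)-z_2)^2},\qquad \mathcal P=\{1,-1\}.$$ Then for all $g\ge0$, $n\ge1$ with $2g-2+n\ge0$, the pull-back under $w_i=\sqrt{\epsilon/2}\,(z_i-z_i^{-1})$, $i=1,\dots,n$, satisfies $$2^{2g-2+n}\,\tilde\omega_{g,n}(w_1,\dots,w_n)\Big|_{w_i=\sqrt{\epsilon/2}\,(z_i-z_i^{-1})}=\omega_{g,n}(z_1,\dots,z_n)$$ at all $z_i\in\mathbb C\setminus\{0\}$ away from the poles, i.e. for $z_i\ne\pm1$ if $2g-2+n>0$, and for $z_1\ne z_2$, $z_1z_2\ne-1$ if $(g,n)=(0,2)$. For $(g,n)=(0,1)$ the same identity, $\tfrac12\tilde y\,d\tilde x=\tfrac12\,y\,dx$, holds near $w=0$, $z=1$, with the branch of $\log z$ that vanishes at $z=1$.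 -/

import Mathlib

open scoped Topology

noncomputable section

namespace TopRec

/-- The residue at `ξ` of the one-form `f(z) dz`: the value of `(2πi)⁻¹ ∮_{|z-ξ|=r} f(z) dz` for small `r > 0`
(for an isolated singularity this is eventually constant in `r`). -/
def residue (f : ℂ → ℂ) (ξ : ℂ) : ℂ :=
  Filter.limUnder (𝓝[>] (0 : ℝ)) fun r : ℝ => (2 * Real.pi * Complex.I)⁻¹ * ∮ z in C(ξ, r), f z

/-- `∫_a^b f(t) dt` along the straight segment from `a` to `b`. -/
def segmentIntegral (f : ℂ → ℂ) (a b : ℂ) : ℂ :=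
  ∫ t in (0 : ℝ)..1, f (a + t * (b - a)) * (b - a)

/-- Input data of the recursion, on a Riemann surface that is an open subset `carrier` of the
affine line with its coordinate `z`. Differentials are recorded by their coefficients:
`dx = deriv x z dz`, and `B z₁ z₂` stands for the bidifferential `B z₁ z₂ dz₁ dz₂`.
As `y` may be multivalued, `y ξ` is a branch of it near the point `ξ ∈ ram`;
`σ ξ` is the deck transformation of `x` near `ξ`. -/
structure RecursionData where
  carrier : Set ℂ
  isOpen_carrier : IsOpen carrier
  ram : Finset ℂ
  ram_subset : ↑ram ⊆ carrier
  x : ℂ → ℂ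
  y : ℂ → ℂ → ℂ
  σ : ℂ → ℂ → ℂ
  B : ℂ → ℂ → ℂ
  x_holo : DifferentiableOn ℂ x carrier
  x_crit : ∀ ξ ∈ ram, deriv x ξ = 0
  x_simple : ∀ ξ ∈ ram, deriv (deriv x) ξ ≠ 0
  y_analytic : ∀ ξ ∈ ram, AnalyticAt ℂ (y ξ) ξ
  dy_ne_zero : ∀ ξ ∈ ram, deriv (y ξ) ξ ≠ 0
  σ_analytic : ∀ ξ ∈ ram, AnalyticAt ℂ (σ ξ) ξ
  σ_fix : ∀ ξ ∈ ram, σ ξ ξ = ξ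
  σ_invol : ∀ ξ ∈ ram, ∀ᶠ z in 𝓝 ξ, σ ξ (σ ξ z) = z
  σ_deck : ∀ ξ ∈ ram, ∀ᶠ z in 𝓝 ξ, x (σ ξ z) = x z
  σ_ne_id : ∀ ξ ∈ ram, ∀ᶠ z in 𝓝[≠] ξ, σ ξ z ≠ z
  B_symm : ∀ z₁ ∈ carrier, ∀ z₂ ∈ carrier, B z₁ z₂ = B z₂ z₁

/-- The recursion kernel at `ξ`,
`∫_z^{σ(z)} B(z₁, ·) / ((y(σ(z)) - y(z)) dx(z))`, as a coefficient of `dz₁ / dz`. -/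
def RecursionData.kernel (D : RecursionData) (ξ z₁ z : ℂ) : ℂ :=
  segmentIntegral (D.B z₁) z (D.σ ξ z) / ((D.y ξ (D.σ ξ z) - D.y ξ z) * deriv D.x z)

/-- `D.omegaAux g m z₁ (z₂, …, z_{m+1})` is the coefficient of `dz₁ ⋯ dz_{m+1}` in the differential
`ω_{g,m+1}` of the topological recursion, `2g - 2 + (m + 1) ≥ 0`. In the sum over splittings
`g = p.1 + (g - p.1)` and `{2, …, m+1} = p.2 ⊔ p.2ᶜ` the two terms that contain `ω_{0,1}` are omitted.
The factor `deriv (D.σ ξ) z` comes from the argument `σ(z)` of a differential: `dσ(z) = σ'(z) dz`.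
The multivalued `ω_{0,1}` never enters and is defined separately; here its place is filled by `0`. -/
def RecursionData.omegaAux (D : RecursionData) (g m : ℕ) (z₁ : ℂ) (zs : Fin m → ℂ) : ℂ :=
  if g = 0 ∧ m = 0 then 0
  else if h02 : g = 0 ∧ m = 1 then D.B z₁ (zs ⟨0, by omega⟩)
  else (1 / 2) * ∑ ξ ∈ D.ram, residue (fun z =>
    D.kernel ξ z₁ z * deriv (D.σ ξ) z *
      ((if 0 < g then
          D.omegaAux (g - 1) (m + 1) z (Fin.cons (D.σ ξ z) zs) else 0) +
        ∑ p : Fin (g + 1) × Finset (Fin m),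
          if (p.1.val = 0 ∧ p.2.card = 0) ∨ (g - p.1.val = 0 ∧ (p.2ᶜ).card = 0) then 0
          else
            D.omegaAux p.1.val p.2.card z (fun j => zs (p.2.orderEmbOfFin rfl j)) *
              D.omegaAux (g - p.1.val) (p.2ᶜ).card (D.σ ξ z)
                (fun j => zs ((p.2ᶜ).orderEmbOfFin rfl j)))) ξ
termination_by 2 * g + m
decreasing_by
  · omega
  · have h1 := p.1.isLt
    have h2 := Finset.card_add_card_compl p.2
    simp only [Fintype.card_fin] at h2
    omega
  · have h1 := p.1.isLt
    have h2 := Finset.card_add_card_compl p.2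
    simp only [Fintype.card_fin] at h2
    omega

/-- The coefficient of `dz₁ ⋯ dz_n`, `n ≥ 1`, `2g - 2 + n ≥ 0`, in `ω_{g,n}`. -/
def RecursionData.omega (D : RecursionData) (g : ℕ) : (n : ℕ) → (Fin n → ℂ) → ℂ
  | 0, _ => 0
  | m + 1, z => D.omegaAux g m (z 0) (Fin.tail z)

/-- Spectral curve data: `B` has a double pole with biresidue `1` on the diagonal and no other poles. -/
structure SpectralCurve extends RecursionData where
  B_regular : ∀ z₁ ∈ carrier, ∀ z₂ ∈ carrier, z₁ ≠ z₂ →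
    AnalyticAt ℂ (fun p : ℂ × ℂ => B p.1 p.2) (z₁, z₂)
  B_diag : ∀ z ∈ carrier, ∃ h : ℂ × ℂ → ℂ, AnalyticAt ℂ h (z, z) ∧
    ∀ᶠ p in 𝓝 (z, z), p.1 ≠ p.2 → B p.1 p.2 = 1 / (p.1 - p.2) ^ 2 + h p

/-- `ω_{0,1} = y dx`, in the branch near the ramification point `ξ`. -/
def SpectralCurve.omega01 (D : SpectralCurve) (ξ z : ℂ) : ℂ :=
  D.y ξ z * deriv D.x z

/-- `G`-equivariant spectral curve data: a free holomorphic action `φ` of a finite group on the curve,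
with `dx`, `dy`, `B` equivariant under the characters `χ`, `υ`, `β`, and `B` with the same
singular part as `∑_η β_η⁻¹ d(η z₁) dz₂ / (η z₁ - z₂)²`.  The points of `ram` are all the zeros of `dx`;
`dy` is (the coefficient of) the single-valued differential of the multivalued `y`. -/
structure EquivariantSpectralCurve (G : Type) [Group G] [Fintype G] extends RecursionData where
  φ : G → ℂ → ℂ
  dy : ℂ → ℂ
  χ : G →* ℂˣ
  υ : G →* ℂˣ
  β : G →* ℂˣ
  φ_mapsTo : ∀ γ, Set.MapsTo (φ γ) carrier carrier
  φ_holo : ∀ γ, DifferentiableOn ℂ (φ γ) carrier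
  φ_one : ∀ z ∈ carrier, φ 1 z = z
  φ_mul : ∀ γ η, ∀ z ∈ carrier, φ (γ * η) z = φ γ (φ η z)
  φ_free : ∀ γ, ∀ z ∈ carrier, φ γ z = z → γ = 1
  x_crit_all : ∀ z ∈ carrier, deriv x z = 0 → z ∈ ram
  dy_mero : ∀ z ∈ carrier, MeromorphicAt dy z
  dy_spec : ∀ ξ ∈ ram, ∀ᶠ z in 𝓝 ξ, HasDerivAt (y ξ) (dy z) z
  dx_equiv : ∀ γ, ∀ z ∈ carrier, deriv x (φ γ z) * deriv (φ γ) z = χ γ * deriv x z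
  dy_equiv : ∀ γ, ∀ z ∈ carrier, dy (φ γ z) * deriv (φ γ) z = υ γ * dy z
  B_equiv : ∀ γ, ∀ z₁ ∈ carrier, ∀ z₂ ∈ carrier,
    B (φ γ z₁) z₂ * deriv (φ γ) z₁ = β γ * B z₁ z₂
  B_regular : ∀ z₁ ∈ carrier, ∀ z₂ ∈ carrier, (∀ γ, φ γ z₁ ≠ z₂) →
    AnalyticAt ℂ (fun p : ℂ × ℂ => B p.1 p.2) (z₁, z₂)
  B_orbit : ∀ γ, ∀ z ∈ carrier, ∃ h : ℂ × ℂ → ℂ, AnalyticAt ℂ h (φ γ z, z) ∧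
    ∀ᶠ p in 𝓝 (φ γ z, z), (∀ η, φ η p.1 ≠ p.2) →
      B p.1 p.2 =
        (∑ η : G, ((β η)⁻¹ : ℂˣ) * (deriv (φ η) p.1 / (φ η p.1 - p.2) ^ 2)) + h p

/-- `ω_{0,1} = |G|⁻¹ y dx`, in the branch near the ramification point `ξ`. -/
def EquivariantSpectralCurve.omega01 {G : Type} [Group G] [Fintype G]
    (D : EquivariantSpectralCurve G) (ξ z : ℂ) : ℂ :=
  (Fintype.card G : ℂ)⁻¹ * (D.y ξ z * deriv D.x z)

/-- The branch of the square root with value `1` at `1`. -/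
def csqrt (u : ℂ) : ℂ := u ^ (1 / 2 : ℂ)

/-- `arcsinh u = log (u + √(1 + u²))`, the branch with value `0` at `0`. -/
def arcsinh (u : ℂ) : ℂ := Complex.log (u + csqrt (1 + u ^ 2))

/-- `2 arcsinh(w / √(2ε)) / √(w² + 2ε)` near `w = 0`, where `r = √(2ε)` and
`√(w² + 2ε) = r √(1 + (w/r)²)` is the branch with value `r` at `w = 0`. -/
def yKN (r w : ℂ) : ℂ := 2 * arcsinh (w / r) / (r * csqrt (1 + (w / r) ^ 2))

lemma csqrt_one : csqrt 1 = 1 := by simp [csqrt]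

lemma yKN_analyticAt (r : ℂ) (hr : r ≠ 0) : AnalyticAt ℂ (yKN r) 0 := by
  have h1 : AnalyticAt ℂ (fun w : ℂ => csqrt (1 + (w / r) ^ 2)) 0 := by
    unfold csqrt
    refine AnalyticAt.cpow (by fun_prop) analyticAt_const ?_
    simp
  have h2 : AnalyticAt ℂ (fun w : ℂ => arcsinh (w / r)) 0 := by
    unfold arcsinh
    refine AnalyticAt.clog ?_ ?_
    · exact AnalyticAt.add (by fun_prop) h1
    · simp [csqrt_one]
  unfold yKN
  refine AnalyticAt.div (analyticAt_const.mul h2) (analyticAt_const.mul h1) ?_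
  simp [csqrt_one, hr]

lemma yKN_hasDerivAt (r : ℂ) (hr : r ≠ 0) : HasDerivAt (yKN r) (2 / r ^ 2) 0 := by
  have hq : HasDerivAt (fun w : ℂ => w / r) (1 / r) 0 := (hasDerivAt_id 0).div_const r
  have h1 : HasDerivAt (fun w : ℂ => csqrt (1 + (w / r) ^ 2)) 0 0 := by
    have ha := (hq.pow 2).const_add 1
    have hb := ha.cpow_const (c := (1 / 2 : ℂ)) (by simp)
    simpa [csqrt] using hb
  have h2 : HasDerivAt (fun w : ℂ => arcsinh (w / r)) (1 / r) 0 := by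
    have ha := (hq.add h1).clog (by simp [csqrt_one])
    simpa [arcsinh, csqrt_one] using ha
  have h3 := (h2.const_mul 2).div (h1.const_mul r) (by simp [csqrt_one, hr])
  have h4 : HasDerivAt (yKN r) _ 0 := h3
  convert h4 using 1
  simp [csqrt_one, arcsinh]
  field_simp

/-- The Kazarian–Norbury spectral curve: `x = w²/2`, `y = 2 arcsinh(w/√(2ε)) / √(w²+2ε)`,
`B = dw₁ dw₂ / (w₁-w₂)²`, with its only ramification point `w = 0`, where `σ(w) = -w`.
Here `r` is a chosen square root of `2ε`. -/
def curveKN (ε r : ℂ) (hε : ε ≠ 0) (hr : r ^ 2 = 2 * ε) : SpectralCurve where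
  carrier := Set.univ
  isOpen_carrier := isOpen_univ
  ram := {0}
  ram_subset := Set.subset_univ _
  x := fun w => w ^ 2 / 2
  y := fun _ => yKN r
  σ := fun _ w => -w
  B := fun w₁ w₂ => 1 / (w₁ - w₂) ^ 2
  x_holo := by fun_prop
  x_crit := by simp
  x_simple := by
    have : deriv (fun w : ℂ => w ^ 2 / 2) = fun w => w := by
      funext w; simp
    simp [this]
  y_analytic := by
    have hr0 : r ≠ 0 := by rintro rfl; simp at hr; exact hε hr
    simpa using yKN_analyticAt r hr0
  dy_ne_zero := by
    have hr0 : r ≠ 0 := by rintro rfl; simp at hr; exact hε hr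
    simp [(yKN_hasDerivAt r hr0).deriv, hr0]
  σ_analytic := by intro ξ _; fun_prop
  σ_fix := by simp
  σ_invol := by simp
  σ_deck := by simp
  σ_ne_id := by
    intro ξ hξ
    simp only [Finset.mem_singleton] at hξ
    subst hξ
    filter_upwards [self_mem_nhdsWithin] with z hz h
    exact hz (self_eq_neg.mp h.symm)
  B_symm := by
    intro z₁ _ z₂ _
    rw [show (z₁ - z₂) ^ 2 = (z₂ - z₁) ^ 2 by ring]
  B_regular := by
    intro z₁ _ z₂ _ h
    refine AnalyticAt.div analyticAt_const ((analyticAt_fst.sub analyticAt_snd).pow 2) ?_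
    exact pow_ne_zero 2 (sub_ne_zero.mpr h)
  B_diag := by
    intro z _
    exact ⟨fun _ => 0, analyticAt_const, Filter.Eventually.of_forall fun p _ => by simp⟩

/-- The action of `ℤ₂ = {1, -1}` generated by `ι(z) = -1/z`. -/
def iotaAction (γ : ℤˣ) (z : ℂ) : ℂ := if γ = 1 then z else -1 / z

/-- The `ℤ₂`-equivariant bidifferential
`dz₁ dz₂ / (z₁-z₂)² + dι(z₁) dz₂ / (ι(z₁)-z₂)²`, where `dι(z₁) = dz₁ / z₁²`. -/
def spinB (z₁ z₂ : ℂ) : ℂ :=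
  1 / (z₁ - z₂) ^ 2 + (1 / z₁ ^ 2) / (-1 / z₁ - z₂) ^ 2

lemma iotaAction_one : iotaAction 1 = fun z => z := by funext z; simp [iotaAction]

lemma iotaAction_neg : iotaAction (-1) = fun z => -1 / z := by
  funext z; simp [iotaAction]

lemma hasDerivAt_iota {z : ℂ} (hz : z ≠ 0) :
    HasDerivAt (fun z : ℂ => -1 / z) (1 / z ^ 2) z := by
  have h : HasDerivAt (fun z : ℂ => -z⁻¹) (- -(z ^ 2)⁻¹) z := (hasDerivAt_inv hz).neg
  simpa [neg_div] using h

lemma deriv_spin_x (s : ℂ) {z : ℂ} (hz : z ≠ 0) :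
    HasDerivAt (fun z : ℂ => s * (z + 1 / z)) (s * (1 - 1 / z ^ 2)) z := by
  have h : HasDerivAt (fun z : ℂ => s * (z + z⁻¹)) (s * (1 + -(z ^ 2)⁻¹)) z :=
    ((hasDerivAt_id z).add (hasDerivAt_inv hz)).const_mul s
  simpa [sub_eq_add_neg] using h

lemma spinB_eq {z₁ z₂ : ℂ} (h : z₁ ≠ 0) :
    spinB z₁ z₂ = 1 / (z₁ - z₂) ^ 2 + 1 / (1 + z₁ * z₂) ^ 2 := by
  unfold spinB
  rw [div_div, ← mul_pow, show z₁ * (-1 / z₁ - z₂) = -(1 + z₁ * z₂) by field_simp; ring, neg_sq]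

/-- The `ℤ₂`-equivariant spectral curve `x = √(ε/2) (z + 1/z)`, `y = 2 log z`,
`B = dz₁ dz₂ / (z₁-z₂)² + dι(z₁) dz₂ / (ι(z₁)-z₂)²`, `ι(z) = -1/z`; `χ = υ` is the sign character and
`β` is trivial.  The ramification points are `±1`, and `σ(z) = 1/z` at both.  The branch of `log z` near `ξ`
is `log (z/ξ) + log ξ`.  Here `s` is a chosen square root of `ε/2`.  The curve is the projective line without
the poles `0`, `∞` of `dx` and the fixed points `±i` of `ι`. -/
def curveSpin (ε s : ℂ) (hε : ε ≠ 0) (hs : s ^ 2 = ε / 2) : EquivariantSpectralCurve ℤˣ where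
  carrier := {z | z ≠ 0 ∧ z ^ 2 ≠ -1}
  isOpen_carrier := by
    refine IsOpen.inter isOpen_ne ?_
    exact isOpen_ne_fun (by fun_prop) (by fun_prop)
  ram := {1, -1}
  ram_subset := by
    intro z hz
    simp only [Finset.coe_insert, Finset.coe_singleton, Set.mem_insert_iff,
      Set.mem_singleton_iff] at hz
    rcases hz with rfl | rfl <;> constructor <;> norm_num
  x := fun z => s * (z + 1 / z)
  y := fun ξ z => 2 * (Complex.log (z / ξ) + Complex.log ξ)
  σ := fun _ z => 1 / z
  B := spinB
  φ := iotaAction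
  dy := fun z => 2 / z
  χ := Units.map (Int.castRingHom ℂ).toMonoidHom
  υ := Units.map (Int.castRingHom ℂ).toMonoidHom
  β := 1
  x_holo := fun z hz => (deriv_spin_x s hz.1).differentiableAt.differentiableWithinAt
  x_crit := by
    intro ξ hξ
    have : ξ ≠ 0 ∧ ξ ^ 2 = 1 := by
      simp only [Finset.mem_insert, Finset.mem_singleton] at hξ
      rcases hξ with rfl | rfl <;> norm_num
    rw [(deriv_spin_x s this.1).deriv, this.2]
    simp
  x_simple := by
    have hs0 : s ≠ 0 := by
      rintro rfl
      apply hε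
      simpa using hs.symm
    intro ξ hξ
    have hξ' : ξ ≠ 0 := by
      simp only [Finset.mem_insert, Finset.mem_singleton] at hξ
      rcases hξ with rfl | rfl <;> norm_num
    have h1 : deriv (fun z : ℂ => s * (z + 1 / z)) =ᶠ[𝓝 ξ] fun z => s * (1 - 1 / z ^ 2) := by
      filter_upwards [isOpen_ne.mem_nhds hξ'] with z hz
      exact (deriv_spin_x s hz).deriv
    have h2 : HasDerivAt (fun z : ℂ => s * (1 - 1 / z ^ 2)) (s * (2 / ξ ^ 3)) ξ := by
      have h : HasDerivAt (fun z : ℂ => s * (1 - (z ^ 2)⁻¹)) _ ξ :=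
        (((hasDerivAt_pow 2 ξ).inv (pow_ne_zero 2 hξ')).const_sub 1).const_mul s
      have e : s * (2 / ξ ^ 3) = s * -(-(((2 : ℕ) : ℂ) * ξ ^ (2 - 1)) / (ξ ^ 2) ^ 2) := by
        field_simp
        norm_num
      rw [e]
      simpa only [one_div] using h
    rw [h1.deriv_eq, h2.deriv]
    exact mul_ne_zero hs0 (div_ne_zero two_ne_zero (pow_ne_zero 3 hξ'))
  y_analytic := by
    intro ξ hξ
    have hξ' : ξ ≠ 0 := by
      simp only [Finset.mem_insert, Finset.mem_singleton] at hξ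
      rcases hξ with rfl | rfl <;> norm_num
    refine analyticAt_const.mul (AnalyticAt.add ?_ analyticAt_const)
    refine AnalyticAt.clog (by fun_prop) ?_
    simp [div_self hξ']
  dy_ne_zero := by
    intro ξ hξ
    have hξ' : ξ ≠ 0 := by
      simp only [Finset.mem_insert, Finset.mem_singleton] at hξ
      rcases hξ with rfl | rfl <;> norm_num
    have h := ((((hasDerivAt_id ξ).div_const ξ).clog (by simp [div_self hξ'])).add_const
      (Complex.log ξ)).const_mul 2
    have h' : HasDerivAt (fun z => 2 * (Complex.log (z / ξ) + Complex.log ξ)) _ ξ := h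
    rw [h'.deriv]
    simp [hξ']
  σ_analytic := by
    intro ξ hξ
    have hξ' : ξ ≠ 0 := by
      simp only [Finset.mem_insert, Finset.mem_singleton] at hξ
      rcases hξ with rfl | rfl <;> norm_num
    exact analyticAt_const.div analyticAt_id hξ'
  σ_fix := by
    intro ξ hξ
    simp only [Finset.mem_insert, Finset.mem_singleton] at hξ
    rcases hξ with rfl | rfl <;> norm_num
  σ_invol := by simp
  σ_deck := by
    intro ξ _
    refine Filter.Eventually.of_forall fun z => ?_
    simp [add_comm]
  σ_ne_id := by
    intro ξ hξ
    have hmem : {z : ℂ | z ≠ 0 ∧ z ≠ -ξ} ∈ 𝓝 ξ := by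
      have hξ' : ξ ≠ 0 ∧ ξ ≠ -ξ := by
        simp only [Finset.mem_insert, Finset.mem_singleton] at hξ
        rcases hξ with rfl | rfl <;> norm_num [Complex.ext_iff]
      exact (isOpen_ne.inter isOpen_ne).mem_nhds hξ'
    filter_upwards [self_mem_nhdsWithin, mem_nhdsWithin_of_mem_nhds hmem] with z hz hz' h
    rw [div_eq_iff hz'.1] at h
    have h' : (z - 1) * (z + 1) = 0 := by linear_combination -h
    simp only [Finset.mem_insert, Finset.mem_singleton] at hξ
    rcases mul_eq_zero.mp h' with h1 | h1 <;> rcases hξ with rfl | rfl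
    · exact hz (by simpa using sub_eq_zero.mp h1)
    · exact hz'.2 (by simpa using sub_eq_zero.mp h1)
    · exact hz'.2 (eq_neg_of_add_eq_zero_left h1)
    · exact hz (eq_neg_of_add_eq_zero_left h1)
  B_symm := by
    intro z₁ h₁ z₂ h₂
    rw [spinB_eq h₁.1, spinB_eq h₂.1, mul_comm z₁ z₂,
      show (z₁ - z₂) ^ 2 = (z₂ - z₁) ^ 2 by ring]
  φ_mapsTo := by
    intro γ z hz
    rcases Int.units_eq_one_or γ with rfl | rfl
    · simpa [iotaAction_one] using hz
    · have hz1 := hz.1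
      refine ⟨by simp [iotaAction_neg, hz.1], ?_⟩
      rw [iotaAction_neg]
      intro h
      field_simp at h
      exact hz.2 (by linear_combination h)
  φ_holo := by
    intro γ z hz
    rcases Int.units_eq_one_or γ with rfl | rfl
    · rw [iotaAction_one]; exact differentiableWithinAt_id
    · rw [iotaAction_neg]
      exact (hasDerivAt_iota hz.1).differentiableAt.differentiableWithinAt
  φ_one := by simp [iotaAction_one]
  φ_mul := by
    intro γ η z _
    rcases Int.units_eq_one_or γ with rfl | rfl <;> rcases Int.units_eq_one_or η with rfl | rfl <;>
      simp [iotaAction_one, iotaAction_neg]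
  φ_free := by
    intro γ z hz h
    rcases Int.units_eq_one_or γ with rfl | rfl
    · rfl
    · rw [iotaAction_neg] at h
      have h' : -1 / z = z := h
      rw [div_eq_iff hz.1] at h'
      exact absurd (by linear_combination -h') hz.2
  x_crit_all := by
    have hs0 : s ≠ 0 := by
      rintro rfl
      apply hε
      simpa using hs.symm
    intro z hz h
    have hz1 := hz.1
    rw [(deriv_spin_x s hz.1).deriv] at h
    have h1 := (mul_eq_zero.mp h).resolve_left hs0
    field_simp at h1
    have h' : (z - 1) * (z + 1) = 0 := by linear_combination h1
    simp only [Finset.mem_insert, Finset.mem_singleton]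
    rcases mul_eq_zero.mp h' with h2 | h2
    · exact Or.inl (sub_eq_zero.mp h2)
    · exact Or.inr (eq_neg_of_add_eq_zero_left h2)
  dy_mero := by intro z _; fun_prop
  dy_spec := by
    intro ξ hξ
    have hξ' : ξ ≠ 0 := by
      simp only [Finset.mem_insert, Finset.mem_singleton] at hξ
      rcases hξ with rfl | rfl <;> norm_num
    have hc : ContinuousAt (fun z : ℂ => z / ξ) ξ := by fun_prop
    have hmem : ∀ᶠ z in 𝓝 ξ, z / ξ ∈ Complex.slitPlane :=
      hc.eventually (Complex.isOpen_slitPlane.mem_nhds (by simp [div_self hξ']))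
    filter_upwards [hmem, isOpen_ne.mem_nhds hξ'] with z hz hz0
    have h := ((((hasDerivAt_id z).div_const ξ).clog hz).add_const (Complex.log ξ)).const_mul 2
    have h' : HasDerivAt (fun z => 2 * (Complex.log (z / ξ) + Complex.log ξ)) _ z := h
    have hz1 : z ≠ 0 := hz0
    have e : 2 / z = 2 * (1 / ξ / (id z / ξ)) := by
      simp only [id]
      field_simp
    rw [e]
    exact h'
  dx_equiv := by
    intro γ z hz
    have hz1 := hz.1
    rcases Int.units_eq_one_or γ with rfl | rfl
    · simp [iotaAction_one]
    · rw [iotaAction_neg, (hasDerivAt_iota hz.1).deriv,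
        (deriv_spin_x s (z := -1 / z) (by simp [hz1])).deriv, (deriv_spin_x s hz1).deriv]
      simp
      field_simp
      ring
  dy_equiv := by
    intro γ z hz
    have hz1 := hz.1
    rcases Int.units_eq_one_or γ with rfl | rfl
    · simp [iotaAction_one]
    · rw [iotaAction_neg, (hasDerivAt_iota hz.1).deriv]
      simp
      field_simp
  B_equiv := by
    intro γ z₁ h₁ z₂ _
    have hz1 := h₁.1
    rcases Int.units_eq_one_or γ with rfl | rfl
    · simp [iotaAction_one]
    · rw [iotaAction_neg, (hasDerivAt_iota hz1).deriv]
      have e1 : -1 / (-1 / z₁) = z₁ := by field_simp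
      have e2 : 1 / (-1 / z₁) ^ 2 = z₁ ^ 2 := by field_simp
      simp only [spinB, e1, e2, MonoidHom.one_apply, Units.val_one]
      have e3 : z₁ ^ 2 / (z₁ - z₂) ^ 2 * (1 / z₁ ^ 2) = 1 / (z₁ - z₂) ^ 2 := by
        rw [div_mul_div_comm, mul_one, mul_comm ((z₁ - z₂) ^ 2), ← div_div,
          div_self (pow_ne_zero 2 hz1)]
      rw [add_mul, e3]
      ring
  B_regular := by
    intro z₁ h₁ z₂ _ h
    have hz1 := h₁.1
    have ha := h 1
    have hb := h (-1)
    rw [iotaAction_one] at ha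
    rw [iotaAction_neg] at hb
    have c1 : AnalyticAt ℂ (fun p : ℂ × ℂ => p.1) (z₁, z₂) := analyticAt_fst
    have c2 : AnalyticAt ℂ (fun p : ℂ × ℂ => p.2) (z₁, z₂) := analyticAt_snd
    unfold spinB
    refine AnalyticAt.add ?_ (AnalyticAt.div ?_ ?_ ?_)
    · exact analyticAt_const.div ((c1.sub c2).pow 2) (pow_ne_zero 2 (sub_ne_zero.mpr ha))
    · exact analyticAt_const.div (c1.pow 2) (pow_ne_zero 2 hz1)
    · exact ((analyticAt_const.div c1 hz1).sub c2).pow 2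
    · exact pow_ne_zero 2 (sub_ne_zero.mpr hb)
  B_orbit := by
    intro γ z hz
    refine ⟨fun _ => 0, analyticAt_const, ?_⟩
    have h0 : iotaAction γ z ≠ 0 := by
      rcases Int.units_eq_one_or γ with rfl | rfl
      · simpa [iotaAction_one] using hz.1
      · simpa [iotaAction_neg] using hz.1
    have hmem : ∀ᶠ p : ℂ × ℂ in 𝓝 (iotaAction γ z, z), p.1 ≠ 0 :=
      continuousAt_fst.eventually_ne h0
    filter_upwards [hmem] with p hp _
    have : (Finset.univ : Finset ℤˣ) = {1, -1} := by decide
    rw [this, Finset.sum_pair (by decide), iotaAction_one, iotaAction_neg,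
      (hasDerivAt_iota hp).deriv]
    simp [spinB]

end TopRec

end

/-!
The residue of a meromorphic differential is invariant under pull-back along a map unramified at the
point. If the input data of one curve are the pull-back of those of another along such a map `φ`,
then, inductively, so are the integrands of the recursion up to a power of `N`, where `N` is the
number of ramification points upstairs over each one downstairs: the sum over the former
contributes one factor `N`, and `2g - 2 + n` is `1` more for `ω_{g,n}` than in total for the factors
of each term of its recursion. Here `φ(z) = √(ε/2) (z - 1/z)` and `N = 2`, as `φ` sends both `1` and
`-1` to `0`.

Residues only transform well if the integrands are meromorphic. This follows by induction as well:
away from the ramification points the stable `ω_{g,n}` are sums of products of functions of one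
variable that are meromorphic at the ramification points.
-/

noncomputable section

namespace TopRec

open Filter

/-- `f(z) dz` has residue `c` at `ξ`: its integral over every sufficiently small circle around `ξ`
is `2πi c`. Unlike `residue`, this comes with integrability and is therefore additive. -/
def HasResidue (f : ℂ → ℂ) (ξ c : ℂ) : Prop :=
  ∀ᶠ r in 𝓝[>] (0 : ℝ),
    CircleIntegrable f ξ r ∧ ∮ z in C(ξ, r), f z = 2 * Real.pi * Complex.I * c

lemma eventually_forall_mem_sphere {p : ℂ → Prop} {ξ : ℂ} (h : ∀ᶠ z in 𝓝[≠] ξ, p z) :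
    ∀ᶠ r in 𝓝[>] (0 : ℝ), 0 < r ∧ ∀ z ∈ Metric.sphere ξ r, p z := by
  rw [eventually_nhdsWithin_iff, Metric.eventually_nhds_iff] at h
  obtain ⟨δ, hδ, h⟩ := h
  filter_upwards [Ioo_mem_nhdsGT hδ] with r hr
  refine ⟨hr.1, fun z hz => h (by rw [Metric.mem_sphere.mp hz]; exact hr.2) ?_⟩
  exact Metric.ne_of_mem_sphere hz hr.1.ne'

namespace HasResidue

variable {f g : ℂ → ℂ} {ξ a b : ℂ}

lemma residue_eq (h : HasResidue f ξ a) : residue f ξ = a := by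
  refine Tendsto.limUnder_eq (tendsto_const_nhds.congr' ?_)
  filter_upwards [h] with r hr
  rw [hr.2, inv_mul_cancel_left₀ Complex.two_pi_I_ne_zero]

lemma congr (h : HasResidue f ξ a) (hfg : f =ᶠ[𝓝[≠] ξ] g) : HasResidue g ξ a := by
  filter_upwards [h, eventually_forall_mem_sphere hfg] with r ⟨hf, hr⟩ ⟨hr₀, heq⟩
  rw [← abs_of_pos hr₀] at heq
  refine ⟨(circleIntegrable_congr heq).mp hf, ?_⟩
  rw [abs_of_pos hr₀] at heq
  rw [← hr, circleIntegral.integral_congr hr₀.le heq]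

lemma add (hf : HasResidue f ξ a) (hg : HasResidue g ξ b) :
    HasResidue (fun z => f z + g z) ξ (a + b) := by
  filter_upwards [hf, hg] with r hf hg
  exact ⟨hf.1.add hg.1, by rw [circleIntegral.integral_add hf.1 hg.1, hf.2, hg.2, mul_add]⟩

lemma const_mul (c : ℂ) (hf : HasResidue f ξ a) : HasResidue (fun z => c * f z) ξ (c * a) := by
  filter_upwards [hf] with r hf
  exact ⟨hf.1.const_smul (a := c), by
    rw [circleIntegral.integral_const_mul, hf.2, mul_left_comm]⟩

lemma of_hasDerivAt (hd : ∀ᶠ z in 𝓝[≠] ξ, HasDerivAt g (f z) z)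
    (hc : ∀ᶠ z in 𝓝[≠] ξ, ContinuousAt f z) : HasResidue f ξ 0 := by
  filter_upwards [eventually_forall_mem_sphere hd, eventually_forall_mem_sphere hc]
    with r ⟨hr, hd⟩ ⟨_, hc⟩
  refine ⟨ContinuousOn.circleIntegrable hr.le fun z hz => (hc z hz).continuousWithinAt, ?_⟩
  rw [mul_zero, circleIntegral.integral_eq_zero_of_hasDerivWithinAt hr.le
    fun z hz => (hd z hz).hasDerivWithinAt]

lemma inv_sub_mul (hf : AnalyticAt ℂ f ξ) : HasResidue (fun z => (z - ξ)⁻¹ * f z) ξ (f ξ) := by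
  obtain ⟨δ, hδ, h⟩ := Metric.eventually_nhds_iff.mp hf.eventually_analyticAt
  filter_upwards [Ioo_mem_nhdsGT hδ] with r ⟨hr, hrδ⟩
  have hd : DifferentiableOn ℂ f (Metric.closedBall ξ r) := fun z hz =>
    (h (Metric.closedBall_subset_ball hrδ hz)).differentiableAt.differentiableWithinAt
  refine ⟨ContinuousOn.circleIntegrable hr.le (ContinuousOn.mul (ContinuousOn.inv₀ (by fun_prop) ?_)
    (hd.continuousOn.mono Metric.sphere_subset_closedBall)), ?_⟩
  · exact fun z hz => sub_ne_zero.mpr (Metric.ne_of_mem_sphere hz hr.ne')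
  · exact hd.circleIntegral_sub_inv_smul (Metric.mem_ball_self hr)

lemma comp_div_sub {φ G : ℂ → ℂ} (hφ : AnalyticAt ℂ φ ξ) (hφ' : deriv φ ξ ≠ 0)
    (hG : AnalyticAt ℂ G (φ ξ)) :
    HasResidue (fun z => G (φ z) / (φ z - φ ξ) * deriv φ z) ξ (G (φ ξ)) := by
  have hψ : AnalyticAt ℂ (dslope φ ξ) ξ :=
    let ⟨_, hp⟩ := hφ; hp.has_fpower_series_dslope_fslope.analyticAt
  have hψ₀ : dslope φ ξ ξ ≠ 0 := by rwa [dslope_same]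
  have h := inv_sub_mul (((hG.comp hφ).mul hφ.deriv).div hψ hψ₀)
  simp only [Pi.mul_apply, Pi.div_apply, Function.comp_apply, dslope_same,
    mul_div_cancel_right₀ _ hφ'] at h
  refine h.congr (Eventually.of_forall fun z => ?_)
  simp only [← sub_smul_dslope φ ξ z, smul_eq_mul]
  simp only [div_eq_mul_inv, mul_inv]
  ring

lemma comp_div_pow {φ : ℂ → ℂ} (hφ : AnalyticAt ℂ φ ξ) (hφ' : deriv φ ξ ≠ 0) (n : ℕ) {G : ℂ → ℂ}
    (hG : AnalyticAt ℂ G (φ ξ)) :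
    HasResidue (fun z => G (φ z) / (φ z - φ ξ) ^ (n + 1) * deriv φ z) ξ
      (iteratedDeriv n G (φ ξ) / n.factorial) := by
  induction n generalizing G with
  | zero => simpa using comp_div_sub hφ hφ' hG
  | succ n ih =>
    have hne : ∀ᶠ z in 𝓝[≠] ξ, φ z ≠ φ ξ :=
      (hφ.differentiableAt.hasDerivAt.tendsto_nhdsNE hφ').eventually self_mem_nhdsWithin
    have hφ_an := hφ.eventually_analyticAt.filter_mono (nhdsWithin_le_nhds (s := {ξ}ᶜ))
    have hG_an := (hφ.continuousAt.eventually hG.eventually_analyticAt).filter_mono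
      (nhdsWithin_le_nhds (s := {ξ}ᶜ))
    -- integration by parts: this function and its derivative trade `G` for `G'`
    let P : ℂ → ℂ := fun z => -(G (φ z) / (φ z - φ ξ) ^ (n + 1)) / (n + 1)
    have hP : ∀ᶠ z in 𝓝[≠] ξ, AnalyticAt ℂ P z ∧ deriv P z =
        G (φ z) / (φ z - φ ξ) ^ (n + 1 + 1) * deriv φ z -
          (n + 1 : ℂ)⁻¹ * (deriv G (φ z) / (φ z - φ ξ) ^ (n + 1) * deriv φ z) := by
      filter_upwards [hne, hφ_an, hG_an] with z hz hφz hGz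
      have hz' := sub_ne_zero.mpr hz
      have hn : (n + 1 : ℂ) ≠ 0 := by exact_mod_cast n.succ_ne_zero
      have hdφ := hφz.differentiableAt.hasDerivAt
      refine ⟨(((hGz.comp hφz).div ((hφz.sub analyticAt_const).pow (n + 1))
        (pow_ne_zero _ hz')).neg).div_const, HasDerivAt.deriv ?_⟩
      refine HasDerivAt.congr_deriv (f := P) ((((hGz.differentiableAt.hasDerivAt.comp z hdφ).div
        ((hdφ.sub_const (φ ξ)).pow (n + 1)) (pow_ne_zero _ hz')).neg).div_const (n + 1 : ℂ)) ?_
      simp only [Function.comp_apply, Pi.pow_apply]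
      push_cast [Nat.add_sub_cancel]
      field_simp
      ring
    have h := (of_hasDerivAt (hP.mono fun z hz => hz.1.differentiableAt.hasDerivAt)
      (hP.mono fun z hz => hz.1.deriv.continuousAt)).add ((ih hG.deriv).const_mul (n + 1 : ℂ)⁻¹)
    rw [zero_add, ← iteratedDeriv_succ', mul_comm, ← div_eq_mul_inv, div_div] at h
    rw [Nat.factorial_succ, mul_comm, Nat.cast_mul, Nat.cast_succ]
    exact h.congr (hP.mono fun z hz => by simp only [hz.2, sub_add_cancel])

end HasResidue

lemma exists_eq_div_pow_succ {f : ℂ → ℂ} {ξ : ℂ} (hf : MeromorphicAt f ξ) :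
    ∃ (n : ℕ) (g : ℂ → ℂ), AnalyticAt ℂ g ξ ∧ ∀ᶠ z in 𝓝[≠] ξ, f z = g z / (z - ξ) ^ (n + 1) := by
  obtain ⟨n, hn⟩ := hf
  refine ⟨n, fun z => (z - ξ) * ((z - ξ) ^ n • f z),
    (analyticAt_id.sub analyticAt_const).mul hn, ?_⟩
  filter_upwards [self_mem_nhdsWithin] with z hz
  rw [smul_eq_mul, ← mul_assoc, ← pow_succ', mul_div_cancel_left₀]
  exact pow_ne_zero _ (sub_ne_zero.mpr hz)

lemma residue_eq_iteratedDeriv_div_factorial {f g : ℂ → ℂ} {ξ : ℂ} {n : ℕ} (hg : AnalyticAt ℂ g ξ)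
    (hf : ∀ᶠ z in 𝓝[≠] ξ, f z = g z / (z - ξ) ^ (n + 1)) :
    residue f ξ = iteratedDeriv n g ξ / n.factorial :=
  ((HasResidue.comp_div_pow (φ := id) analyticAt_id (by simp) n hg).congr
    (hf.mono fun z hz => by simp [hz])).residue_eq

lemma hasResidue_comp_mul_deriv {f φ : ℂ → ℂ} {ξ : ℂ} (hφ : AnalyticAt ℂ φ ξ)
    (hφ' : deriv φ ξ ≠ 0) (hf : MeromorphicAt f (φ ξ)) :
    HasResidue (fun z => f (φ z) * deriv φ z) ξ (residue f (φ ξ)) := by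
  obtain ⟨n, g, hg, hfg⟩ := exists_eq_div_pow_succ hf
  rw [residue_eq_iteratedDeriv_div_factorial hg hfg]
  refine (HasResidue.comp_div_pow hφ hφ' n hg).congr ?_
  filter_upwards [(hφ.differentiableAt.hasDerivAt.tendsto_nhdsNE hφ').eventually hfg] with z hz
  rw [hz]

lemma segmentIntegral_eq_sub {f F : ℂ → ℂ} {a b : ℂ} {U : Set ℂ} (hU : Convex ℝ U) (ha : a ∈ U)
    (hb : b ∈ U) (hF : ∀ z ∈ U, HasDerivAt F (f z) z) (hf : ContinuousOn f U) :
    segmentIntegral f a b = F b - F a := by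
  have hmem : ∀ t ∈ Set.uIcc (0 : ℝ) 1, a + t * (b - a) ∈ U := fun t ht =>
    hU.add_smul_sub_mem ha hb (Set.uIcc_of_le (zero_le_one' ℝ) ▸ ht)
  have hline (t : ℝ) : HasDerivAt (fun t : ℝ => a + t * (b - a)) (b - a) t := by
    simpa using ((Complex.ofRealCLM.hasDerivAt (x := t)).mul_const (b - a)).const_add a
  have h := intervalIntegral.integral_eq_sub_of_hasDerivAt
    (fun t ht => (hF _ (hmem t ht)).comp t (hline t))
    (((hf.comp (by fun_prop) hmem).mul continuousOn_const).intervalIntegrable)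
  simpa [segmentIntegral] using h

lemma eventually_segmentIntegral_eq_sub {f F : ℂ → ℂ} {ξ : ℂ}
    (hF : ∀ᶠ z in 𝓝 ξ, HasDerivAt F (f z) z) :
    ∀ᶠ p : ℂ × ℂ in 𝓝 (ξ, ξ), segmentIntegral f p.1 p.2 = F p.2 - F p.1 := by
  obtain ⟨δ, hδ, hball⟩ := Metric.eventually_nhds_iff_ball.mp hF
  have hFd : DifferentiableOn ℂ F (Metric.ball ξ δ) := fun z hz =>
    (hball z hz).differentiableAt.differentiableWithinAt
  have hf : ContinuousOn f (Metric.ball ξ δ) :=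
    (hFd.deriv Metric.isOpen_ball).continuousOn.congr fun z hz => (hball z hz).deriv.symm
  filter_upwards [prod_mem_nhds (Metric.ball_mem_nhds ξ hδ) (Metric.ball_mem_nhds ξ hδ)] with p hp
  exact segmentIntegral_eq_sub (convex_ball ξ δ) hp.1 hp.2 hball hf

lemma exists_eventually_hasDerivAt {f : ℂ → ℂ} {ξ : ℂ} (hf : AnalyticAt ℂ f ξ) :
    ∃ F : ℂ → ℂ, ∀ᶠ z in 𝓝 ξ, HasDerivAt F (f z) z := by
  obtain ⟨δ, hδ, hball⟩ := Metric.eventually_nhds_iff_ball.mp hf.eventually_analyticAt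
  obtain ⟨F, hF⟩ := DifferentiableOn.isExactOn_ball (f := f) (c := ξ) (r := δ) fun z hz =>
    (hball z hz).differentiableAt.differentiableWithinAt
  exact ⟨F, Metric.eventually_nhds_iff_ball.mpr ⟨δ, hδ, hF⟩⟩

lemma eventually_hasDerivAt_segmentIntegral {f σ : ℂ → ℂ} {ξ : ℂ} (hf : AnalyticAt ℂ f ξ)
    (hσ : AnalyticAt ℂ σ ξ) (hσξ : σ ξ = ξ) :
    ∀ᶠ w in 𝓝 ξ, HasDerivAt (fun w => segmentIntegral f w (σ w)) (f (σ w) * deriv σ w - f w) w := by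
  obtain ⟨F, hF⟩ := exists_eventually_hasDerivAt hf
  have hσ_tendsto : Tendsto σ (𝓝 ξ) (𝓝 ξ) := by simpa [hσξ] using hσ.continuousAt.tendsto
  have hseg : ∀ᶠ w in 𝓝 ξ, segmentIntegral f w (σ w) = F (σ w) - F w :=
    (tendsto_id.prodMk_nhds hσ_tendsto).eventually (eventually_segmentIntegral_eq_sub hF)
  filter_upwards [hseg.eventually_nhds, hF, hσ_tendsto.eventually hF, hσ.eventually_analyticAt]
    with w hw hFw hFσ hσw
  exact ((hFσ.comp w hσw.differentiableAt.hasDerivAt).sub hFw).congr_of_eventuallyEq hw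

lemma eventually_segmentIntegral_comp_mul_deriv_eq {f g φ : ℂ → ℂ} {ξ c : ℂ} (hφ : AnalyticAt ℂ φ ξ)
    (hf : AnalyticAt ℂ f (φ ξ)) (hg : ∀ᶠ z in 𝓝 ξ, g z = c * (f (φ z) * deriv φ z)) :
    ∀ᶠ p : ℂ × ℂ in 𝓝 (ξ, ξ),
      segmentIntegral g p.1 p.2 = c * segmentIntegral f (φ p.1) (φ p.2) := by
  obtain ⟨F, hF⟩ := exists_eventually_hasDerivAt hf
  have hG : ∀ᶠ z in 𝓝 ξ, HasDerivAt (fun z => c * F (φ z)) (g z) z := by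
    filter_upwards [hg, hφ.continuousAt.eventually hF, hφ.eventually_analyticAt] with z hz hFz hφz
    exact hz ▸ (hFz.comp z hφz.differentiableAt.hasDerivAt).const_mul c
  have hφφ : Tendsto (Prod.map φ φ) (𝓝 (ξ, ξ)) (𝓝 (φ ξ, φ ξ)) :=
    hφ.continuousAt.prodMap hφ.continuousAt
  filter_upwards [eventually_segmentIntegral_eq_sub hG,
    hφφ.eventually (eventually_segmentIntegral_eq_sub hF)] with p hgp hfp
  simp only [Prod.map_fst, Prod.map_snd] at hfp
  rw [hgp, hfp, mul_sub]

section Families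

variable {X : Type*} (S : Subalgebra ℂ (X → ℂ)) (ζ : ℂ)

/-- The families `G p`, `p : X`, of analytic functions at `ζ` all of whose Taylor coefficients,
as functions of the parameter `p`, belong to the algebra `S`. -/
def analyticFamily : Subalgebra ℂ (X → ℂ → ℂ) where
  carrier := {G | (∀ p, AnalyticAt ℂ (G p) ζ) ∧ ∀ k, (fun p => iteratedDeriv k (G p) ζ) ∈ S}
  add_mem' {G H} hG hH := ⟨fun p => (hG.1 p).add (hH.1 p), fun k => by
    simp only [Pi.add_apply, iteratedDeriv_add (hG.1 _).contDiffAt (hH.1 _).contDiffAt]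
    exact S.add_mem (hG.2 k) (hH.2 k)⟩
  mul_mem' {G H} hG hH := ⟨fun p => (hG.1 p).mul (hH.1 p), fun k => by
    simp only [Pi.mul_apply, iteratedDeriv_mul (hG.1 _).contDiffAt (hH.1 _).contDiffAt]
    convert S.sum_mem fun i (_ : i ∈ Finset.range (k + 1)) =>
      S.mul_mem (S.mul_mem (S.natCast_mem (k.choose i)) (hG.2 i)) (hH.2 (k - i)) using 1
    ext p
    simp⟩
  algebraMap_mem' c := ⟨fun _ => analyticAt_const, fun k =>
    S.algebraMap_mem (iteratedDeriv k (fun _ => c) ζ)⟩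

variable {S ζ}

lemma const_mem_analyticFamily {c : X → ℂ} (hc : c ∈ S) :
    (fun p _ => c p) ∈ analyticFamily S ζ :=
  ⟨fun _ => analyticAt_const, fun k => by
    simp only [iteratedDeriv_const]
    split_ifs
    exacts [hc, S.zero_mem]⟩

lemma mem_analyticFamily_of_analyticAt {f : ℂ → ℂ} (hf : AnalyticAt ℂ f ζ) :
    (fun _ => f) ∈ analyticFamily S ζ :=
  ⟨fun _ => hf, fun k => S.algebraMap_mem (iteratedDeriv k f ζ)⟩

lemma mem_analyticFamily_of_hasDerivAt {G G' : X → ℂ → ℂ} (h₀ : (fun p => G p ζ) ∈ S)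
    (hG' : G' ∈ analyticFamily S ζ) (h : ∀ p, ∀ᶠ w in 𝓝 ζ, HasDerivAt (G p) (G' p w) w) :
    G ∈ analyticFamily S ζ := by
  refine ⟨fun p => Complex.analyticAt_iff_eventually_differentiableAt.mpr
    ((h p).mono fun w hw => hw.differentiableAt), fun k => ?_⟩
  cases k with
  | zero => simpa only [iteratedDeriv_zero] using h₀
  | succ k =>
    simp only [iteratedDeriv_succ',
      Filter.EventuallyEq.iteratedDeriv_eq k ((h _).mono fun _ hw => hw.deriv)]
    exact hG'.2 k

variable (S ζ) in
/-- The families `F p`, `p : X`, of germs of meromorphic functions at `ζ`, with a pole of bounded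
order, all of whose Laurent coefficients, as functions of `p`, belong to the algebra `S`. -/
def laurentFamily : Subalgebra ℂ (X → ℂ → ℂ) where
  carrier := {F | ∃ n : ℕ, ∃ G ∈ analyticFamily S ζ,
    ∀ p, ∀ᶠ w in 𝓝[≠] ζ, F p w = G p w / (w - ζ) ^ n}
  add_mem' := by
    rintro F₁ F₂ ⟨n₁, G₁, hG₁, h₁⟩ ⟨n₂, G₂, hG₂, h₂⟩
    have hpow (n : ℕ) : (fun (_ : X) w => (w - ζ) ^ n) ∈ analyticFamily S ζ :=
      mem_analyticFamily_of_analyticAt (by fun_prop)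
    refine ⟨n₁ + n₂, G₁ * _ + G₂ * _, add_mem (mul_mem hG₁ (hpow n₂)) (mul_mem hG₂ (hpow n₁)),
      fun p => ?_⟩
    filter_upwards [h₁ p, h₂ p, self_mem_nhdsWithin] with w hw₁ hw₂ hw
    have hwζ := sub_ne_zero.mpr hw
    simp only [Pi.add_apply, Pi.mul_apply, hw₁, hw₂]
    field_simp
    ring
  mul_mem' := by
    rintro F₁ F₂ ⟨n₁, G₁, hG₁, h₁⟩ ⟨n₂, G₂, hG₂, h₂⟩
    refine ⟨n₁ + n₂, G₁ * G₂, mul_mem hG₁ hG₂, fun p => ?_⟩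
    filter_upwards [h₁ p, h₂ p] with w hw₁ hw₂
    simp only [Pi.mul_apply, hw₁, hw₂, pow_add, div_mul_div_comm]
  algebraMap_mem' c := ⟨0, algebraMap ℂ _ c, Subalgebra.algebraMap_mem _ c, fun p => by simp⟩

lemma analyticFamily_le_laurentFamily : analyticFamily S ζ ≤ laurentFamily S ζ :=
  fun G hG => ⟨0, G, hG, fun p => by simp⟩

lemma mem_laurentFamily_congr {F F' : X → ℂ → ℂ} (hF : F ∈ laurentFamily S ζ)
    (h : ∀ p, ∀ᶠ w in 𝓝[≠] ζ, F' p w = F p w) : F' ∈ laurentFamily S ζ := by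
  obtain ⟨n, G, hG, hFG⟩ := hF
  exact ⟨n, G, hG, fun p => by filter_upwards [h p, hFG p] with w h₁ h₂ using h₁.trans h₂⟩

lemma mem_laurentFamily_of_meromorphicAt {f : ℂ → ℂ} (hf : MeromorphicAt f ζ) :
    (fun _ => f) ∈ laurentFamily S ζ := by
  obtain ⟨n, g, hg, hfg⟩ := exists_eq_div_pow_succ hf
  exact ⟨n + 1, _, mem_analyticFamily_of_analyticAt hg, fun _ => hfg⟩

lemma meromorphicAt_of_mem_laurentFamily {F : X → ℂ → ℂ} (hF : F ∈ laurentFamily S ζ) (p : X) :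
    MeromorphicAt (F p) ζ := by
  obtain ⟨n, G, hG, h⟩ := hF
  exact ((hG.1 p).meromorphicAt.div (by fun_prop)).congr ((h p).mono fun w hw => hw.symm)

lemma residue_mem_of_mem_laurentFamily {F : X → ℂ → ℂ} (hF : F ∈ laurentFamily S ζ) :
    (fun p => residue (F p) ζ) ∈ S := by
  obtain ⟨n, G, hG, h⟩ := hF
  have hsub : (fun (_ : X) w => w - ζ) ∈ analyticFamily S ζ :=
    mem_analyticFamily_of_analyticAt (by fun_prop)
  have hG₁ := mul_mem hsub hG
  have hres (p : X) : residue (F p) ζ = (n.factorial : ℂ)⁻¹ *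
      iteratedDeriv n (((fun (_ : X) w => w - ζ) * G) p) ζ := by
    rw [residue_eq_iteratedDeriv_div_factorial (hG₁.1 p), div_eq_inv_mul]
    filter_upwards [h p, self_mem_nhdsWithin] with w hw hwζ
    rw [hw, Pi.mul_apply, Pi.mul_apply, pow_succ', mul_div_mul_left _ _ (sub_ne_zero.mpr hwζ)]
  simp only [hres]
  exact S.smul_mem (hG₁.2 n) _

end Families

section Separable

variable {R U : Set ℂ} {X ι κ : Type*} {S : Subalgebra ℂ (X → ℂ)} {ζ : ℂ}

variable (R U ι) in
/-- The algebra of functions of `p : ι → U` generated by the functions of a single coordinate `p i`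
that are restrictions of functions meromorphic at every point of `R`. -/
def separable : Subalgebra ℂ ((ι → U) → ℂ) :=
  Algebra.adjoin ℂ {F | ∃ i f, (∀ ζ ∈ R, MeromorphicAt f ζ) ∧ F = fun p => f (p i)}

lemma coord_mem_separable (i : ι) {f : ℂ → ℂ} (hf : ∀ ζ ∈ R, MeromorphicAt f ζ) :
    (fun p : ι → U => f (p i)) ∈ separable R U ι :=
  Algebra.subset_adjoin ⟨i, f, hf, rfl⟩

lemma exists_mem_laurentFamily_of_mem_separable {v : κ → X → ℂ → ℂ}
    (hv : ∀ k f, (∀ ζ ∈ R, MeromorphicAt f ζ) → (fun p w => f (v k p w)) ∈ laurentFamily S ζ)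
    {F : (κ → U) → ℂ} (hF : F ∈ separable R U κ) :
    ∃ Φ ∈ laurentFamily S ζ,
      ∀ p w (h : ∀ k, v k p w ∈ U), Φ p w = F fun k => ⟨v k p w, h k⟩ := by
  induction hF using Algebra.adjoin_induction with
  | mem F hF =>
    obtain ⟨k, f, hf, rfl⟩ := hF
    exact ⟨_, hv k f hf, fun _ _ _ => rfl⟩
  | algebraMap c => exact ⟨algebraMap ℂ _ c, Subalgebra.algebraMap_mem _ c, fun _ _ _ => rfl⟩
  | add F₁ F₂ _ _ h₁ h₂ =>
    obtain ⟨⟨Φ₁, hΦ₁, h₁⟩, Φ₂, hΦ₂, h₂⟩ := h₁, h₂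
    exact ⟨Φ₁ + Φ₂, add_mem hΦ₁ hΦ₂, fun p w h => congrArg₂ (· + ·) (h₁ p w h) (h₂ p w h)⟩
  | mul F₁ F₂ _ _ h₁ h₂ =>
    obtain ⟨⟨Φ₁, hΦ₁, h₁⟩, Φ₂, hΦ₂, h₂⟩ := h₁, h₂
    exact ⟨Φ₁ * Φ₂, mul_mem hΦ₁ hΦ₂, fun p w h => congrArg₂ (· * ·) (h₁ p w h) (h₂ p w h)⟩

lemma comp_mem_laurentFamily_of_mem_separable {v : κ → X → ℂ → ℂ}
    (hv : ∀ k f, (∀ ζ ∈ R, MeromorphicAt f ζ) → (fun p w => f (v k p w)) ∈ laurentFamily S ζ)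
    (hvU : ∀ p, ∀ᶠ w in 𝓝[≠] ζ, ∀ k, v k p w ∈ U) {A : (κ → ℂ) → ℂ}
    (hA : (fun q : κ → U => A fun k => q k) ∈ separable R U κ) :
    (fun p w => A fun k => v k p w) ∈ laurentFamily S ζ := by
  obtain ⟨Φ, hΦ, h⟩ := exists_mem_laurentFamily_of_mem_separable hv hA
  exact mem_laurentFamily_congr hΦ fun p => (hvU p).mono fun w hw => by rw [h p w hw]

end Separable

/-- Differentiating `H / D ^ n` in `t` gives a quotient of the same shape, so every `t`-derivative
at `b` is a quotient of functions that are analytic in `q` at `a`. -/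
lemma meromorphicAt_iteratedDeriv_div_pow {D : ℂ × ℂ → ℂ} {a b : ℂ} (hD : AnalyticAt ℂ D (a, b))
    (hD₀ : ∀ᶠ q in 𝓝[≠] a, D (q, b) ≠ 0) (k : ℕ) {H : ℂ × ℂ → ℂ} (hH : AnalyticAt ℂ H (a, b))
    (n : ℕ) : MeromorphicAt (fun q => iteratedDeriv k (fun t => H (q, t) / D (q, t) ^ n) b) a := by
  induction k generalizing H n with
  | zero =>
    have hslice : AnalyticAt ℂ (fun q : ℂ => (q, b)) a := by fun_prop
    simp only [iteratedDeriv_zero]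
    exact (hH.comp_of_eq hslice rfl).meromorphicAt.div
      ((hD.comp_of_eq hslice rfl).meromorphicAt.pow n)
  | succ k ih =>
    let dt (f : ℂ × ℂ → ℂ) (p : ℂ × ℂ) : ℂ := fderiv ℂ f p (0, 1)
    have hdt {f : ℂ × ℂ → ℂ} (hf : AnalyticAt ℂ f (a, b)) : AnalyticAt ℂ (dt f) (a, b) :=
      ((ContinuousLinearMap.apply ℂ ℂ ((0, 1) : ℂ × ℂ)).analyticAt _).comp hf.fderiv
    have hderiv {f : ℂ × ℂ → ℂ} {q t : ℂ} (hf : AnalyticAt ℂ f (q, t)) :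
        HasDerivAt (fun t => f (q, t)) (dt f (q, t)) t :=
      hf.differentiableAt.hasFDerivAt.comp_hasDerivAt t
        ((hasDerivAt_const t q).prodMk (hasDerivAt_id t))
    refine (ih (((hdt hH).mul hD).sub ((analyticAt_const (v := (n : ℂ))).mul (hH.mul (hdt hD))))
      (n + 1)).congr ?_
    have hcurry {f : ℂ × ℂ → ℂ} (hf : AnalyticAt ℂ f (a, b)) :
        ∀ᶠ q in 𝓝[≠] a, ∀ᶠ t in 𝓝 b, AnalyticAt ℂ f (q, t) :=
      hf.eventually_analyticAt.curry_nhds.filter_mono nhdsWithin_le_nhds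
    filter_upwards [hD₀, hcurry hD, hcurry hH] with q hq hDq hHq
    rw [iteratedDeriv_succ']
    refine EventuallyEq.iteratedDeriv_eq k ?_
    have hDt := (hderiv hDq.self_of_nhds).continuousAt.eventually_ne hq
    filter_upwards [hDt, hDq, hHq] with t ht hDt hHt
    refine (((hderiv hHt).div ((hderiv hDt).pow n) (pow_ne_zero n ht)).congr_deriv ?_).deriv.symm
    rcases n with _ | n
    · simp [ht]
    · simp only [Pi.pow_apply, Pi.sub_apply, Pi.mul_apply, Nat.cast_add, Nat.cast_one,
        add_tsub_cancel_right]
      field_simp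
      ring

section RecursionData

variable {D : RecursionData} {ξ : ℂ}

lemma RecursionData.deriv_σ_ne_zero (hξ : ξ ∈ D.ram) : deriv (D.σ ξ) ξ ≠ 0 := by
  have hσ := (D.σ_analytic ξ hξ).differentiableAt.hasDerivAt
  have hσσ : HasDerivAt (D.σ ξ ∘ D.σ ξ) (deriv (D.σ ξ) ξ * deriv (D.σ ξ) ξ) ξ :=
    HasDerivAt.comp ξ ((D.σ_fix ξ hξ).symm ▸ hσ) hσ
  have hid := hσσ.unique ((hasDerivAt_id ξ).congr_of_eventuallyEq (D.σ_invol ξ hξ))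
  exact left_ne_zero_of_mul (hid ▸ one_ne_zero)

lemma RecursionData.tendsto_σ (hξ : ξ ∈ D.ram) : Tendsto (D.σ ξ) (𝓝[≠] ξ) (𝓝[≠] ξ) := by
  simpa only [D.σ_fix ξ hξ] using (D.σ_analytic ξ hξ).differentiableAt.hasDerivAt.tendsto_nhdsNE
    (D.deriv_σ_ne_zero hξ)

lemma RecursionData.analyticAt_deriv_x (hξ : ξ ∈ D.ram) : AnalyticAt ℂ (deriv D.x) ξ :=
  (D.x_holo.analyticAt (D.isOpen_carrier.mem_nhds (D.ram_subset hξ))).deriv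

lemma RecursionData.eventually_mem_carrier_diff_ram (hξ : ξ ∈ D.ram) :
    ∀ᶠ z in 𝓝[≠] ξ, z ∈ D.carrier \ D.ram := by
  have hfin : ∀ᶠ z in 𝓝[≠] ξ, z ∉ (D.ram : Set ℂ) := by
    have h := (D.ram.finite_toSet.subset (Set.sdiff_subset (t := {ξ}))).isClosed.compl_mem_nhds
      (x := ξ) (by simp)
    filter_upwards [mem_nhdsWithin_of_mem_nhds h, self_mem_nhdsWithin] with z hz hzξ hzr
    exact hz ⟨hzr, hzξ⟩
  filter_upwards [mem_nhdsWithin_of_mem_nhds (D.isOpen_carrier.mem_nhds (D.ram_subset hξ)), hfin]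
    with z hz hz' using ⟨hz, hz'⟩

end RecursionData

lemma SpectralCurve.exists_analyticAt_B_eq (E : SpectralCurve) {a b : ℂ} (ha : a ∈ E.carrier)
    (hb : b ∈ E.carrier) : ∃ H : ℂ × ℂ → ℂ, AnalyticAt ℂ H (a, b) ∧
      ∀ᶠ p in 𝓝 (a, b), p.1 ≠ p.2 → E.B p.1 p.2 = H p / (p.1 - p.2) ^ 2 := by
  rcases eq_or_ne a b with rfl | hab
  · obtain ⟨h, hh, hB⟩ := E.B_diag a ha
    refine ⟨fun p => 1 + (p.1 - p.2) ^ 2 * h p,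
      analyticAt_const.add (((analyticAt_fst.sub analyticAt_snd).pow 2).mul hh), ?_⟩
    filter_upwards [hB] with p hp hne
    have := sub_ne_zero.mpr hne
    rw [hp hne]
    field_simp
  · refine ⟨fun p => (p.1 - p.2) ^ 2 * E.B p.1 p.2, ?_, Eventually.of_forall fun p hp => ?_⟩
    · exact ((analyticAt_fst.sub analyticAt_snd).pow 2).mul (E.B_regular a ha b hb hab)
    · rw [mul_div_cancel_left₀ _ (pow_ne_zero 2 (sub_ne_zero.mpr hp))]

section Recursion

variable (D : RecursionData)

/-- The contribution of one splitting `g = p.1 + (g - p.1)`, `{2, …, m+1} = p.2 ⊔ p.2ᶜ` to the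
recursion for `ω_{g,m+1}`, as a coefficient of `dz dσ(z) dz₂ ⋯ dz_{m+1}`; `0` if it contains
`ω_{0,1}`. -/
def RecursionData.splitTerm (g m : ℕ) (ξ z : ℂ) (zs : Fin m → ℂ)
    (p : Fin (g + 1) × Finset (Fin m)) : ℂ :=
  if (p.1.val = 0 ∧ p.2.card = 0) ∨ (g - p.1.val = 0 ∧ (p.2ᶜ).card = 0) then 0
  else
    D.omegaAux p.1.val p.2.card z (fun j => zs (p.2.orderEmbOfFin rfl j)) *
      D.omegaAux (g - p.1.val) (p.2ᶜ).card (D.σ ξ z) (fun j => zs ((p.2ᶜ).orderEmbOfFin rfl j))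

/-- The bracket in the recursion for `ω_{g,m+1}`, as a coefficient of `dz dσ(z) dz₂ ⋯ dz_{m+1}`. -/
def RecursionData.quadraticTerm (g m : ℕ) (ξ z : ℂ) (zs : Fin m → ℂ) : ℂ :=
  (if 0 < g then D.omegaAux (g - 1) (m + 1) z (Fin.cons (D.σ ξ z) zs) else 0) +
    ∑ p, D.splitTerm g m ξ z zs p

/-- The differential in `z` whose residue at `ξ` enters the recursion for `ω_{g,m+1}`. -/
def RecursionData.integrand (g m : ℕ) (ξ z₁ : ℂ) (zs : Fin m → ℂ) (z : ℂ) : ℂ :=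
  D.kernel ξ z₁ z * deriv (D.σ ξ) z * D.quadraticTerm g m ξ z zs

lemma RecursionData.omegaAux_zero_one (z₁ : ℂ) (zs : Fin 1 → ℂ) :
    D.omegaAux 0 1 z₁ zs = D.B z₁ (zs 0) := by
  rw [RecursionData.omegaAux]; simp

lemma RecursionData.omegaAux_stable {g m : ℕ} (h : 1 < 2 * g + m) (z₁ : ℂ) (zs : Fin m → ℂ) :
    D.omegaAux g m z₁ zs = 1 / 2 * ∑ ξ ∈ D.ram, residue (D.integrand g m ξ z₁ zs) ξ := by
  rw [RecursionData.omegaAux, if_neg (by omega), dif_neg (by omega)]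
  rfl

end Recursion

section Separability

/-- The curve without the ramification points, where the stable `ω_{g,n}` are regular. -/
def RecursionData.regularLocus (D : RecursionData) : Set ℂ := D.carrier \ D.ram

variable {E : SpectralCurve} {ι : Type*} {ζ : ℂ} {u : ℂ → ℂ}

lemma SpectralCurve.meromorphicAt_iteratedDeriv_B {a : ℂ} (ha : a ∈ E.carrier) (hζ : ζ ∈ E.ram)
    (hu : AnalyticAt ℂ u ζ) (huζ : u ζ = ζ) (k : ℕ) :
    MeromorphicAt (fun q => iteratedDeriv k (fun t => E.B q (u t)) ζ) a := by
  obtain ⟨H, hH, hB⟩ := E.exists_analyticAt_B_eq ha (E.ram_subset hζ)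
  have hu₂ : AnalyticAt ℂ (fun p : ℂ × ℂ => u p.2) (a, ζ) :=
    AnalyticAt.comp_of_eq hu analyticAt_snd rfl
  have hne : ∀ᶠ q in 𝓝[≠] a, q ≠ ζ := (hasDerivAt_id a).eventually_ne one_ne_zero
  refine (meromorphicAt_iteratedDeriv_div_pow (analyticAt_fst.sub hu₂)
    (hne.mono fun q hq => by simpa [huζ, sub_eq_zero] using hq) k
    (H := fun p => H (p.1, u p.2)) (hH.comp_of_eq (analyticAt_fst.prod hu₂) (by rw [huζ]))
    2).congr ?_
  have hB' : ∀ᶠ p : ℂ × ℂ in 𝓝 (a, ζ), p.1 ≠ u p.2 →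
      E.B p.1 (u p.2) = H (p.1, u p.2) / (p.1 - u p.2) ^ 2 := by
    refine Tendsto.eventually (f := fun p : ℂ × ℂ => (p.1, u p.2)) ?_ hB
    simpa [ContinuousAt, huζ] using (analyticAt_fst.prod hu₂).continuousAt
  filter_upwards [hne, hB'.curry_nhds.filter_mono nhdsWithin_le_nhds] with q hq hBq
  refine EventuallyEq.iteratedDeriv_eq k ?_
  filter_upwards [hBq, hu.continuousAt.eventually_ne (huζ.trans_ne hq.symm)] with t ht hqt
  exact (ht hqt.symm).symm

lemma SpectralCurve.B_mem_analyticFamily (hζ : ζ ∈ E.ram) (hu : AnalyticAt ℂ u ζ) (huζ : u ζ = ζ)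
    (i : ι) : (fun p w => E.B (p i) (u w)) ∈
      analyticFamily (separable (E.ram : Set ℂ) E.regularLocus ι) ζ := by
  refine ⟨fun p => ?_, fun k => coord_mem_separable i fun a ha =>
    E.meromorphicAt_iteratedDeriv_B (E.ram_subset ha) hζ hu huζ k⟩
  have hne : (p i : ℂ) ≠ u ζ := fun h => (p i).2.2 (h ▸ huζ.symm ▸ hζ)
  have hreg := E.B_regular (p i) (p i).2.1 (u ζ) (huζ.symm ▸ E.ram_subset hζ) hne
  exact hreg.comp_of_eq (analyticAt_const.prod hu) rfl

lemma SpectralCurve.kernel_mem_laurentFamily (hζ : ζ ∈ E.ram) (i : ι) :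
    (fun p w => E.kernel ζ (p i) w) ∈
      laurentFamily (separable (E.ram : Set ℂ) E.regularLocus ι) ζ := by
  have hσ := E.σ_analytic ζ hζ
  have hσζ := E.σ_fix ζ hζ
  have hB {u : ℂ → ℂ} (hu : AnalyticAt ℂ u ζ) (huζ : u ζ = ζ) :=
    E.B_mem_analyticFamily hζ hu huζ i
  have hseg : (fun p w => segmentIntegral (E.B (p i)) w (E.σ ζ w)) ∈
      analyticFamily (separable (E.ram : Set ℂ) E.regularLocus ι) ζ := by
    refine mem_analyticFamily_of_hasDerivAt ?_
      (sub_mem (mul_mem (hB hσ hσζ) (mem_analyticFamily_of_analyticAt hσ.deriv))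
        (hB analyticAt_id rfl))
      fun p => eventually_hasDerivAt_segmentIntegral ((hB analyticAt_id rfl).1 p) hσ hσζ
    simp only [hσζ, segmentIntegral, sub_self, mul_zero, intervalIntegral.integral_zero]
    exact zero_mem _
  have hy := E.y_analytic ζ hζ
  have hden : MeromorphicAt (fun w => ((E.y ζ (E.σ ζ w) - E.y ζ w) * deriv E.x w)⁻¹) ζ :=
    (((hy.comp_of_eq hσ hσζ).sub hy).mul (E.analyticAt_deriv_x hζ)).meromorphicAt.inv
  exact mul_mem (analyticFamily_le_laurentFamily hseg) (mem_laurentFamily_of_meromorphicAt hden)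

lemma SpectralCurve.meromorphicAt_B_σ (hζ : ζ ∈ E.ram) :
    MeromorphicAt (fun w => E.B w (E.σ ζ w)) ζ := by
  obtain ⟨H, hH, hB⟩ := E.exists_analyticAt_B_eq (E.ram_subset hζ) (E.ram_subset hζ)
  have hσ := E.σ_analytic ζ hζ
  have hpair : AnalyticAt ℂ (fun w => (w, E.σ ζ w)) ζ := analyticAt_id.prod hσ
  have hpair_ζ : (ζ, E.σ ζ ζ) = (ζ, ζ) := by rw [E.σ_fix ζ hζ]
  refine ((hH.comp_of_eq hpair hpair_ζ).meromorphicAt.div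
    ((analyticAt_id.sub hσ).meromorphicAt.pow 2)).congr ?_
  filter_upwards [E.σ_ne_id ζ hζ,
    (hpair.continuousAt.eventually (hpair_ζ.symm ▸ hB)).filter_mono nhdsWithin_le_nhds]
    with w hw hBw
  exact (hBw hw.symm).symm

variable (E) in
/-- `ω_{g,m+1}` is, away from the ramification points, a sum of products of functions of one
variable that are meromorphic at the ramification points. -/
def SpectralCurve.HasSeparableOmega (g m : ℕ) : Prop :=
  (fun q : Fin (m + 1) → E.regularLocus => E.omegaAux g m (q 0) fun j => q j.succ) ∈
    separable (E.ram : Set ℂ) E.regularLocus (Fin (m + 1))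

lemma SpectralCurve.omegaAux_comp_mem_laurentFamily {g m : ℕ} (hom : E.HasSeparableOmega g m)
    (hζ : ζ ∈ E.ram) {v : Fin (m + 1) → (ι → E.regularLocus) → ℂ → ℂ}
    (hv : ∀ k, (∃ i, v k = fun p _ => p i) ∨
      ∃ u, AnalyticAt ℂ u ζ ∧ u ζ = ζ ∧ Tendsto u (𝓝[≠] ζ) (𝓝[≠] ζ) ∧ v k = fun _ => u) :
    (fun p w => E.omegaAux g m (v 0 p w) fun j => v j.succ p w) ∈
      laurentFamily (separable (E.ram : Set ℂ) E.regularLocus ι) ζ := by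
  refine comp_mem_laurentFamily_of_mem_separable
    (A := fun q => E.omegaAux g m (q 0) fun j => q j.succ)
    (fun k f hf => ?_) (fun p => eventually_all.mpr fun k => ?_) hom
  · obtain ⟨i, hk⟩ | ⟨u, hu, huζ, -, hk⟩ := hv k <;> rw [hk]
    · exact analyticFamily_le_laurentFamily (const_mem_analyticFamily (coord_mem_separable i hf))
    · exact mem_laurentFamily_of_meromorphicAt
        ((huζ.symm ▸ hf ζ hζ : MeromorphicAt f (u ζ)).comp_analyticAt hu)
  · obtain ⟨i, hk⟩ | ⟨u, -, -, hu, hk⟩ := hv k <;> rw [hk]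
    · exact Eventually.of_forall fun _ => (p i).2
    · exact hu.eventually (E.eventually_mem_carrier_diff_ram hζ)

lemma SpectralCurve.omegaAux_mem_laurentFamily {g m : ℕ} (h : ¬(g = 0 ∧ m = 0))
    (hom : 1 < 2 * g + m → E.HasSeparableOmega g m) (hζ : ζ ∈ E.ram) (hu : AnalyticAt ℂ u ζ)
    (huζ : u ζ = ζ) (hu' : Tendsto u (𝓝[≠] ζ) (𝓝[≠] ζ)) (e : Fin m → ι) :
    (fun p w => E.omegaAux g m (u w) fun j => p (e j)) ∈
      laurentFamily (separable (E.ram : Set ℂ) E.regularLocus ι) ζ := by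
  by_cases hst : 1 < 2 * g + m
  · exact E.omegaAux_comp_mem_laurentFamily (hom hst) hζ
      (v := Fin.cons (fun _ => u) fun j p _ => p (e j))
      (Fin.cases (.inr ⟨u, hu, huζ, hu', rfl⟩) fun j => .inl ⟨e j, rfl⟩)
  · obtain ⟨rfl, rfl⟩ : g = 0 ∧ m = 1 := by omega
    simp only [RecursionData.omegaAux_zero_one]
    refine mem_laurentFamily_congr
      (analyticFamily_le_laurentFamily (E.B_mem_analyticFamily hζ hu huζ (e 0))) fun p => ?_
    filter_upwards [hu'.eventually (E.eventually_mem_carrier_diff_ram hζ)] with w hw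
    exact E.B_symm _ hw.1 _ (p (e 0)).2.1

lemma SpectralCurve.splitTerm_mem_laurentFamily {g m : ℕ}
    (hom : ∀ g' m', 2 * g' + m' < 2 * g + m → 1 < 2 * g' + m' → E.HasSeparableOmega g' m')
    (hζ : ζ ∈ E.ram) (e : Fin m → ι) (s : Fin (g + 1) × Finset (Fin m)) :
    (fun p w => E.splitTerm g m ζ w (fun j => p (e j)) s) ∈
      laurentFamily (separable (E.ram : Set ℂ) E.regularLocus ι) ζ := by
  have hs := s.1.isLt
  have hcard := Finset.card_add_card_compl s.2
  rw [Fintype.card_fin] at hcard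
  by_cases h : (s.1.val = 0 ∧ s.2.card = 0) ∨ (g - s.1.val = 0 ∧ (s.2ᶜ).card = 0)
  · simp only [RecursionData.splitTerm, if_pos h]
    exact zero_mem _
  · simp only [RecursionData.splitTerm, if_neg h]
    exact mul_mem
      (E.omegaAux_mem_laurentFamily (by omega) (hom _ _ (by omega)) hζ analyticAt_id rfl tendsto_id
        fun j => e (s.2.orderEmbOfFin rfl j))
      (E.omegaAux_mem_laurentFamily (by omega) (hom _ _ (by omega)) hζ (E.σ_analytic ζ hζ)
        (E.σ_fix ζ hζ) (E.tendsto_σ hζ) fun j => e ((s.2ᶜ).orderEmbOfFin rfl j))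

lemma SpectralCurve.loopTerm_mem_laurentFamily {g m : ℕ}
    (hom : 1 < 2 * g + (m + 1) → E.HasSeparableOmega g (m + 1)) (hζ : ζ ∈ E.ram) (e : Fin m → ι) :
    (fun p w => E.omegaAux g (m + 1) w (Fin.cons (E.σ ζ w) fun j => p (e j))) ∈
      laurentFamily (separable (E.ram : Set ℂ) E.regularLocus ι) ζ := by
  by_cases h : 1 < 2 * g + (m + 1)
  · have hv := E.omegaAux_comp_mem_laurentFamily (hom h) hζ (ι := ι)
      (v := Fin.cons (fun _ w => w) (Fin.cons (fun _ => E.σ ζ) fun j p _ => p (e j)))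
      (Fin.cases (.inr ⟨_, analyticAt_id, rfl, tendsto_id, rfl⟩)
        (Fin.cases (.inr ⟨_, E.σ_analytic ζ hζ, E.σ_fix ζ hζ, E.tendsto_σ hζ, rfl⟩)
          fun j => .inl ⟨e j, rfl⟩))
    exact mem_laurentFamily_congr hv fun p => Eventually.of_forall fun w =>
      congrArg _ (funext (Fin.cases rfl fun _ => rfl))
  · obtain ⟨rfl, rfl⟩ : g = 0 ∧ m = 0 := by omega
    simp only [E.omegaAux_zero_one]
    exact mem_laurentFamily_of_meromorphicAt (E.meromorphicAt_B_σ hζ)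

lemma SpectralCurve.integrand_mem_laurentFamily {g m : ℕ}
    (hom : ∀ g' m', 2 * g' + m' < 2 * g + m → 1 < 2 * g' + m' → E.HasSeparableOmega g' m')
    (hζ : ζ ∈ E.ram) (i : ι) (e : Fin m → ι) :
    (fun p w => E.integrand g m ζ (p i) (fun j => p (e j)) w) ∈
      laurentFamily (separable (E.ram : Set ℂ) E.regularLocus ι) ζ := by
  refine mul_mem (mul_mem (E.kernel_mem_laurentFamily hζ i)
    (mem_laurentFamily_of_meromorphicAt (E.σ_analytic ζ hζ).deriv.meromorphicAt))
    (add_mem ?_ ?_)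
  · split_ifs with hg
    · exact E.loopTerm_mem_laurentFamily (hom _ _ (by omega)) hζ e
    · exact zero_mem _
  · convert sum_mem fun s (_ : s ∈ Finset.univ) => E.splitTerm_mem_laurentFamily hom hζ e s using 1
    ext p w
    rw [Finset.sum_apply, Finset.sum_apply]

theorem SpectralCurve.hasSeparableOmega (E : SpectralCurve) (g m : ℕ) (h : 1 < 2 * g + m) :
    E.HasSeparableOmega g m := by
  induction hN : 2 * g + m using Nat.strong_induction_on generalizing g m with
  | _ N ih =>
    subst hN
    simp only [HasSeparableOmega, E.omegaAux_stable h]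
    have hsum := sum_mem fun ζ hζ => residue_mem_of_mem_laurentFamily
      (E.integrand_mem_laurentFamily (fun g' m' hlt hst => ih _ hlt g' m' hst rfl) hζ
        (0 : Fin (m + 1)) Fin.succ)
    convert Subalgebra.smul_mem _ hsum (1 / 2 : ℂ) using 1
    ext q
    simp only [Pi.smul_apply, Finset.sum_apply, smul_eq_mul]

theorem SpectralCurve.meromorphicAt_integrand (hζ : ζ ∈ E.ram) (g : ℕ) {m : ℕ} {z₁ : ℂ}
    (hz₁ : z₁ ∈ E.regularLocus) {zs : Fin m → ℂ} (hzs : ∀ j, zs j ∈ E.regularLocus) :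
    MeromorphicAt (E.integrand g m ζ z₁ zs) ζ :=
  meromorphicAt_of_mem_laurentFamily
    (E.integrand_mem_laurentFamily (fun g' m' _ => E.hasSeparableOmega g' m') hζ
      (0 : Fin (m + 1)) Fin.succ) (Fin.cons ⟨z₁, hz₁⟩ fun j => ⟨zs j, hzs j⟩)

end Separability

section Pullback

/-- On the open set `V` the data `D` are the pull-back of the data `E` along the holomorphic map
`φ`, which is unramified over `E.ram` and maps exactly `N` points of `D.ram` to each point of
`E.ram`. The function `y` enters the recursion only through `(y ∘ σ - y) dx`, so only this is
required to be a pull-back. -/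
structure RecursionData.IsPullback (D E : RecursionData) (φ : ℂ → ℂ) (V : Set ℂ) (N : ℕ) :
    Prop where
  isOpen : IsOpen V
  differentiableOn : DifferentiableOn ℂ φ V
  mapsTo : Set.MapsTo φ V E.carrier
  ram_subset : ↑D.ram ⊆ V
  map_mem_ram_iff : ∀ z ∈ V, φ z ∈ E.ram ↔ z ∈ D.ram
  deriv_ne_zero : ∀ ξ ∈ D.ram, deriv φ ξ ≠ 0
  card_fiber : ∀ ζ ∈ E.ram, (D.ram.filter (φ · = ζ)).card = N
  map_σ : ∀ ξ ∈ D.ram, ∀ᶠ z in 𝓝 ξ, φ (D.σ ξ z) = E.σ (φ ξ) (φ z)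
  y_dx_eq : ∀ ξ ∈ D.ram, ∀ᶠ z in 𝓝 ξ, (D.y ξ (D.σ ξ z) - D.y ξ z) * deriv D.x z =
    (E.y (φ ξ) (E.σ (φ ξ) (φ z)) - E.y (φ ξ) (φ z)) * deriv E.x (φ z) * deriv φ z
  B_eq : ∀ z₁ ∈ V, ∀ z₂ ∈ V, φ z₁ ≠ φ z₂ →
    D.B z₁ z₂ = deriv φ z₁ * deriv φ z₂ * E.B (φ z₁) (φ z₂)

namespace RecursionData.IsPullback

variable {φ : ℂ → ℂ} {V : Set ℂ} {N : ℕ} {ξ z₁ : ℂ}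

section RecursionData

variable {D E : RecursionData}

lemma analyticAt (h : D.IsPullback E φ V N) (hξ : ξ ∈ D.ram) : AnalyticAt ℂ φ ξ :=
  h.differentiableOn.analyticAt (h.isOpen.mem_nhds (h.ram_subset hξ))

lemma map_mem_ram (h : D.IsPullback E φ V N) (hξ : ξ ∈ D.ram) : φ ξ ∈ E.ram :=
  (h.map_mem_ram_iff ξ (h.ram_subset hξ)).mpr hξ

lemma map_mem_regularLocus (h : D.IsPullback E φ V N) (hz : z₁ ∈ V \ D.ram) :
    φ z₁ ∈ E.regularLocus :=
  ⟨h.mapsTo hz.1, fun hr => hz.2 ((h.map_mem_ram_iff z₁ hz.1).mp hr)⟩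

lemma map_ne_map (h : D.IsPullback E φ V N) (hz : z₁ ∈ V \ D.ram) (hξ : ξ ∈ D.ram) :
    φ z₁ ≠ φ ξ :=
  fun he => (h.map_mem_regularLocus hz).2 (he ▸ h.map_mem_ram hξ)

lemma eventually_mem_diff_ram (h : D.IsPullback E φ V N) (hξ : ξ ∈ D.ram) :
    ∀ᶠ z in 𝓝[≠] ξ, z ∈ V \ D.ram := by
  filter_upwards [D.eventually_mem_carrier_diff_ram hξ,
    mem_nhdsWithin_of_mem_nhds (h.isOpen.mem_nhds (h.ram_subset hξ))] with z hz hzV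
    using ⟨hzV, hz.2⟩

lemma eventually_map_ne_map (h : D.IsPullback E φ V N) (hz : z₁ ∈ V \ D.ram) (hξ : ξ ∈ D.ram) :
    ∀ᶠ z in 𝓝 ξ, φ z₁ ≠ φ z :=
  ((h.analyticAt hξ).continuousAt.eventually_ne (h.map_ne_map hz hξ).symm).mono fun _ => Ne.symm

lemma eventually_deriv_mul_deriv_σ_eq (h : D.IsPullback E φ V N) (hξ : ξ ∈ D.ram) :
    ∀ᶠ z in 𝓝 ξ, deriv φ (D.σ ξ z) * deriv (D.σ ξ) z = deriv (E.σ (φ ξ)) (φ z) * deriv φ z := by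
  have hφ := h.analyticAt hξ
  have hσ := D.σ_analytic ξ hξ
  have hσ_tendsto : Tendsto (D.σ ξ) (𝓝 ξ) (𝓝 ξ) := by
    simpa only [ContinuousAt, D.σ_fix ξ hξ] using hσ.continuousAt
  have hEσ := (E.σ_analytic _ (h.map_mem_ram hξ)).eventually_analyticAt
  filter_upwards [(h.map_σ ξ hξ).eventually_nhds, hφ.eventually_analyticAt,
    hσ_tendsto.eventually hφ.eventually_analyticAt, hσ.eventually_analyticAt,
    hφ.continuousAt.eventually hEσ] with z hz hφz hφσ hσz hEσz
  have hd := hφσ.differentiableAt.hasDerivAt.comp z hσz.differentiableAt.hasDerivAt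
  exact (hd.congr_of_eventuallyEq (EventuallyEq.symm hz)).unique
    (hEσz.differentiableAt.hasDerivAt.comp z hφz.differentiableAt.hasDerivAt)

end RecursionData

lemma eventually_kernel_mul_deriv_eq {D : RecursionData} {E : SpectralCurve}
    (h : D.IsPullback E.toRecursionData φ V N) (hz₁ : z₁ ∈ V \ D.ram) (hξ : ξ ∈ D.ram) :
    ∀ᶠ z in 𝓝 ξ, D.kernel ξ z₁ z * deriv φ z = deriv φ z₁ * E.kernel (φ ξ) (φ z₁) (φ z) := by
  have hφ := h.analyticAt hξ
  have hB : AnalyticAt ℂ (E.B (φ z₁)) (φ ξ) := (E.B_regular _ (h.mapsTo hz₁.1) _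
    (h.mapsTo (h.ram_subset hξ)) (h.map_ne_map hz₁ hξ)).curry_right
  have hDB : ∀ᶠ z in 𝓝 ξ, D.B z₁ z = deriv φ z₁ * (E.B (φ z₁) (φ z) * deriv φ z) := by
    filter_upwards [h.isOpen.mem_nhds (h.ram_subset hξ), h.eventually_map_ne_map hz₁ hξ]
      with z hz hne
    rw [h.B_eq z₁ hz₁.1 z hz hne]
    ring
  have hpair : Tendsto (fun z => (z, D.σ ξ z)) (𝓝 ξ) (𝓝 (ξ, ξ)) := by
    simpa only [ContinuousAt, D.σ_fix ξ hξ, id] using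
      (analyticAt_id.prod (D.σ_analytic ξ hξ)).continuousAt
  filter_upwards [hpair.eventually (eventually_segmentIntegral_comp_mul_deriv_eq hφ hB hDB),
    h.map_σ ξ hξ, h.y_dx_eq ξ hξ,
    hφ.deriv.continuousAt.eventually_ne (h.deriv_ne_zero ξ hξ)]
    with z hseg hσ hy hne
  rw [RecursionData.kernel, RecursionData.kernel, hseg, hσ, hy, div_mul_eq_mul_div,
    mul_div_mul_right _ _ hne, mul_div_assoc]

end RecursionData.IsPullback

lemma prod_orderEmbOfFin_mul_prod_orderEmbOfFin_compl {M : Type*} [CommMonoid M] {m : ℕ}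
    (s : Finset (Fin m)) (f : Fin m → M) :
    (∏ j, f (s.orderEmbOfFin rfl j)) * ∏ j, f (sᶜ.orderEmbOfFin rfl j) = ∏ i, f i := by
  have hprod (t : Finset (Fin m)) : ∏ j, f (t.orderEmbOfFin rfl j) = ∏ i ∈ t, f i := by
    conv_rhs => rw [← Finset.map_orderEmbOfFin_univ t rfl, Finset.prod_map]
    rfl
  rw [hprod, hprod, Finset.prod_mul_prod_compl]

/-- `ω_{g,m+1}` of `D` is `N ^ (2g - 2 + (m + 1))` times the pull-back along `φ` of `ω_{g,m+1}` of
`E`, at the points of `V` where neither side has a pole. -/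
def OmegaPullback (D E : RecursionData) (φ : ℂ → ℂ) (V : Set ℂ) (N g m : ℕ) : Prop :=
  ∀ (z₁ : ℂ) (zs : Fin m → ℂ), z₁ ∈ V \ D.ram → (∀ j, zs j ∈ V \ D.ram) →
    (2 * g + m = 1 → ∀ j, φ z₁ ≠ φ (zs j)) →
    D.omegaAux g m z₁ zs = N ^ (2 * g + m - 1) * (deriv φ z₁ * ∏ j, deriv φ (zs j)) *
      E.omegaAux g m (φ z₁) fun j => φ (zs j)

section Quadratic

variable {D E : RecursionData} {φ : ℂ → ℂ} {V : Set ℂ} {N g m : ℕ} {ξ z : ℂ} {zs : Fin m → ℂ}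

lemma OmegaPullback.splitTerm_eq
    (hom : ∀ g' m', 2 * g' + m' < 2 * g + m → ¬(g' = 0 ∧ m' = 0) → OmegaPullback D E φ V N g' m')
    (hz : z ∈ V \ D.ram) (hσz : D.σ ξ z ∈ V \ D.ram) (hφσ : φ (D.σ ξ z) = E.σ (φ ξ) (φ z))
    (hzs : ∀ j, zs j ∈ V \ D.ram) (hne : ∀ j, φ z ≠ φ (zs j)) (hσne : ∀ j, φ (D.σ ξ z) ≠ φ (zs j))
    (s : Fin (g + 1) × Finset (Fin m)) :
    D.splitTerm g m ξ z zs s =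
      N ^ (2 * g + m - 2) * (deriv φ z * deriv φ (D.σ ξ z) * ∏ j, deriv φ (zs j)) *
        E.splitTerm g m (φ ξ) (φ z) (fun j => φ (zs j)) s := by
  have hs := s.1.isLt
  have hcard := Finset.card_add_card_compl s.2
  rw [Fintype.card_fin] at hcard
  by_cases h : (s.1.val = 0 ∧ s.2.card = 0) ∨ (g - s.1.val = 0 ∧ (s.2ᶜ).card = 0)
  · rw [RecursionData.splitTerm, RecursionData.splitTerm, if_pos h, if_pos h, mul_zero]
  · have hpow : 2 * g + m - 2 =
        (2 * s.1.val + s.2.card - 1) + (2 * (g - s.1.val) + (s.2ᶜ).card - 1) := by omega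
    rw [RecursionData.splitTerm, RecursionData.splitTerm, if_neg h, if_neg h,
      hom _ _ (by omega) (by omega) _ _ hz (fun _ => hzs _) fun _ _ => hne _,
      hom _ _ (by omega) (by omega) _ _ hσz (fun _ => hzs _) fun _ _ => hσne _, hφσ, hpow, pow_add,
      ← prod_orderEmbOfFin_mul_prod_orderEmbOfFin_compl s.2]
    ring

lemma OmegaPullback.loopTerm_eq (hg : 0 < g) (hom : OmegaPullback D E φ V N (g - 1) (m + 1))
    (hz : z ∈ V \ D.ram) (hσz : D.σ ξ z ∈ V \ D.ram) (hφσ : φ (D.σ ξ z) = E.σ (φ ξ) (φ z))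
    (hzs : ∀ j, zs j ∈ V \ D.ram) (hσz_ne : φ z ≠ φ (D.σ ξ z)) :
    D.omegaAux (g - 1) (m + 1) z (Fin.cons (D.σ ξ z) zs) =
      N ^ (2 * g + m - 2) * (deriv φ z * deriv φ (D.σ ξ z) * ∏ j, deriv φ (zs j)) *
        E.omegaAux (g - 1) (m + 1) (φ z) (Fin.cons (E.σ (φ ξ) (φ z)) fun j => φ (zs j)) := by
  have hcons : (fun j => φ ((Fin.cons (D.σ ξ z) zs : Fin (m + 1) → ℂ) j)) =
      Fin.cons (E.σ (φ ξ) (φ z)) fun j => φ (zs j) :=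
    funext (Fin.cases hφσ fun _ => rfl)
  have hpow : 2 * (g - 1) + (m + 1) - 1 = 2 * g + m - 2 := by omega
  rw [hom z (Fin.cons (D.σ ξ z) zs) hz (Fin.cases hσz hzs) ?_, hcons, hpow, Fin.prod_univ_succ]
  · simp only [Fin.cons_zero, Fin.cons_succ]
    ring
  · intro h
    obtain rfl : m = 0 := by omega
    exact Fin.cases hσz_ne finZeroElim

lemma OmegaPullback.quadraticTerm_eq
    (hom : ∀ g' m', 2 * g' + m' < 2 * g + m → ¬(g' = 0 ∧ m' = 0) → OmegaPullback D E φ V N g' m')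
    (hz : z ∈ V \ D.ram) (hσz : D.σ ξ z ∈ V \ D.ram) (hφσ : φ (D.σ ξ z) = E.σ (φ ξ) (φ z))
    (hσz_ne : φ z ≠ φ (D.σ ξ z)) (hzs : ∀ j, zs j ∈ V \ D.ram) (hne : ∀ j, φ z ≠ φ (zs j))
    (hσne : ∀ j, φ (D.σ ξ z) ≠ φ (zs j)) :
    D.quadraticTerm g m ξ z zs =
      N ^ (2 * g + m - 2) * (deriv φ z * deriv φ (D.σ ξ z) * ∏ j, deriv φ (zs j)) *
        E.quadraticTerm g m (φ ξ) (φ z) fun j => φ (zs j) := by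
  rw [RecursionData.quadraticTerm, RecursionData.quadraticTerm, mul_add, Finset.mul_sum]
  refine congrArg₂ (· + ·) ?_
    (Finset.sum_congr rfl fun s _ => OmegaPullback.splitTerm_eq hom hz hσz hφσ hzs hne hσne s)
  split_ifs with hg
  · exact OmegaPullback.loopTerm_eq hg (hom _ _ (by omega) (by omega)) hz hσz hφσ hzs hσz_ne
  · rw [mul_zero]

end Quadratic

namespace RecursionData.IsPullback

variable {D : RecursionData} {E : SpectralCurve} {φ : ℂ → ℂ} {V : Set ℂ} {N g m : ℕ} {ξ z₁ : ℂ}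
  {zs : Fin m → ℂ}

lemma eventually_integrand_eq (h : D.IsPullback E.toRecursionData φ V N)
    (hom : ∀ g' m', 2 * g' + m' < 2 * g + m → ¬(g' = 0 ∧ m' = 0) →
      OmegaPullback D E.toRecursionData φ V N g' m')
    (hξ : ξ ∈ D.ram) (hz₁ : z₁ ∈ V \ D.ram) (hzs : ∀ j, zs j ∈ V \ D.ram) :
    ∀ᶠ z in 𝓝[≠] ξ, D.integrand g m ξ z₁ zs z =
      N ^ (2 * g + m - 2) * (deriv φ z₁ * ∏ j, deriv φ (zs j)) *
        (E.integrand g m (φ ξ) (φ z₁) (fun j => φ (zs j)) (φ z) * deriv φ z) := by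
  have near {p : ℂ → Prop} (hp : ∀ᶠ z in 𝓝 ξ, p z) : ∀ᶠ z in 𝓝[≠] ξ, p z :=
    hp.filter_mono nhdsWithin_le_nhds
  have hφ := (h.analyticAt hξ).differentiableAt.hasDerivAt.tendsto_nhdsNE (h.deriv_ne_zero ξ hξ)
  have hV := h.eventually_mem_diff_ram hξ
  have hne : ∀ᶠ z in 𝓝[≠] ξ, ∀ j, φ z ≠ φ (zs j) := eventually_all.mpr fun j =>
    (near (h.eventually_map_ne_map (hzs j) hξ)).mono fun _ => Ne.symm
  have hσ := D.tendsto_σ hξ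
  filter_upwards [near (h.eventually_kernel_mul_deriv_eq hz₁ hξ),
    near (h.eventually_deriv_mul_deriv_σ_eq hξ),
    near (h.map_σ ξ hξ), hφ.eventually (E.σ_ne_id _ (h.map_mem_ram hξ)), hV, hσ.eventually hV,
    hne, hσ.eventually hne] with z hK hσ' hφσ hσz_ne hz hσz hzne hσzne
  rw [RecursionData.integrand, RecursionData.integrand,
    OmegaPullback.quadraticTerm_eq hom hz hσz hφσ (hφσ.trans_ne hσz_ne).symm hzs hzne hσzne]
  linear_combination
    N ^ (2 * g + m - 2) * (∏ j, deriv φ (zs j)) *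
      E.quadraticTerm g m (φ ξ) (φ z) (fun j => φ (zs j)) *
      (deriv φ (D.σ ξ z) * deriv (D.σ ξ) z * hK + deriv φ z₁ * E.kernel (φ ξ) (φ z₁) (φ z) * hσ')

lemma residue_integrand_eq (h : D.IsPullback E.toRecursionData φ V N)
    (hom : ∀ g' m', 2 * g' + m' < 2 * g + m → ¬(g' = 0 ∧ m' = 0) →
      OmegaPullback D E.toRecursionData φ V N g' m')
    (hξ : ξ ∈ D.ram) (hz₁ : z₁ ∈ V \ D.ram) (hzs : ∀ j, zs j ∈ V \ D.ram) :
    residue (D.integrand g m ξ z₁ zs) ξ =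
      N ^ (2 * g + m - 2) * (deriv φ z₁ * ∏ j, deriv φ (zs j)) *
        residue (E.integrand g m (φ ξ) (φ z₁) fun j => φ (zs j)) (φ ξ) := by
  have hmero := E.meromorphicAt_integrand (h.map_mem_ram hξ) g (h.map_mem_regularLocus hz₁)
    fun j => h.map_mem_regularLocus (hzs j)
  have hres := hasResidue_comp_mul_deriv (h.analyticAt hξ) (h.deriv_ne_zero ξ hξ) hmero
  exact ((hres.const_mul _).congr
    ((h.eventually_integrand_eq hom hξ hz₁ hzs).mono fun z => Eq.symm)).residue_eq

lemma sum_ram_comp {E : RecursionData} (h : D.IsPullback E φ V N) (f : ℂ → ℂ) :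
    ∑ ξ ∈ D.ram, f (φ ξ) = N * ∑ ζ ∈ E.ram, f ζ := by
  rw [← Finset.sum_fiberwise_of_maps_to' (fun ξ => h.map_mem_ram) f, Finset.mul_sum]
  exact Finset.sum_congr rfl fun ζ hζ => by rw [Finset.sum_const, h.card_fiber ζ hζ, nsmul_eq_mul]

theorem omegaPullback (h : D.IsPullback E.toRecursionData φ V N) (g m : ℕ)
    (hgm : ¬(g = 0 ∧ m = 0)) : OmegaPullback D E.toRecursionData φ V N g m := by
  induction hk : 2 * g + m using Nat.strong_induction_on generalizing g m with
  | _ k ih =>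
    subst hk
    intro z₁ zs hz₁ hzs hne
    by_cases hst : 1 < 2 * g + m
    · have hres (ξ : ℂ) (hξ : ξ ∈ D.ram) := h.residue_integrand_eq (g := g)
        (fun g' m' hlt hgm' => ih _ hlt g' m' hgm' rfl) hξ hz₁ hzs
      have hpow : 2 * g + m - 1 = (2 * g + m - 2) + 1 := by omega
      rw [D.omegaAux_stable hst, E.omegaAux_stable hst, Finset.sum_congr rfl hres, ← Finset.mul_sum,
        h.sum_ram_comp fun ζ => residue (E.integrand g m ζ (φ z₁) fun j => φ (zs j)) ζ, hpow,
        pow_succ]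
      ring
    · obtain ⟨rfl, rfl⟩ : g = 0 ∧ m = 1 := by omega
      rw [D.omegaAux_zero_one, E.omegaAux_zero_one, Fin.prod_univ_one,
        h.B_eq z₁ hz₁.1 (zs 0) (hzs 0).1 (hne rfl 0), pow_zero, one_mul]

theorem omega_eq (h : D.IsPullback E.toRecursionData φ V N) {n : ℕ} (hn : 1 ≤ n)
    (hgn : 2 < 2 * g + n) {z : Fin n → ℂ} (hz : ∀ i, z i ∈ V \ D.ram) :
    D.omega g n z = (N : ℂ) ^ (2 * (g : ℤ) - 2 + n) *
      (E.omega g n (fun i => φ (z i)) * ∏ i, deriv φ (z i)) := by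
  obtain ⟨m, rfl⟩ := Nat.exists_eq_add_of_le' hn
  have hexp : 2 * (g : ℤ) - 2 + (m + 1 : ℕ) = (2 * g + m - 1 : ℕ) := by omega
  rw [hexp, zpow_natCast, Fin.prod_univ_succ, mul_comm (E.omega _ _ _), ← mul_assoc]
  exact h.omegaPullback g m (by omega) (z 0) (Fin.tail z) (hz 0) (fun j => hz j.succ) (by omega)

theorem omega_zero_two_eq {E : RecursionData} (h : D.IsPullback E φ V N) {z : Fin 2 → ℂ}
    (hz : ∀ i, z i ∈ V) (hne : φ (z 0) ≠ φ (z 1)) :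
    D.omega 0 2 z = E.omega 0 2 (fun i => φ (z i)) * ∏ i, deriv φ (z i) := by
  rw [Fin.prod_univ_two, mul_comm]
  rw [RecursionData.omega, RecursionData.omega, RecursionData.omegaAux_zero_one,
    RecursionData.omegaAux_zero_one]
  exact h.B_eq (z 0) (hz 0) (z 1) (hz 1) hne

end RecursionData.IsPullback

end Pullback

section SpinCover

variable {ε s r z z₁ z₂ ξ : ℂ}

lemma ne_zero_of_sq_eq_half (hε : ε ≠ 0) (hs : s ^ 2 = ε / 2) : s ≠ 0 := by
  rintro rfl
  exact hε (by simpa using hs.symm)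

lemma eq_two_mul_or_eq_neg_two_mul (hs : s ^ 2 = ε / 2) (hr : r ^ 2 = 2 * ε) :
    r = 2 * s ∨ r = -(2 * s) :=
  sq_eq_sq_iff_eq_or_eq_neg.mp (by rw [hr, mul_pow, hs]; ring)

lemma hasDerivAt_mul_sub_inv (s : ℂ) (hz : z ≠ 0) :
    HasDerivAt (fun t : ℂ => s * (t - t⁻¹)) (s * (1 + (z ^ 2)⁻¹)) z :=
  (((hasDerivAt_id z).sub (hasDerivAt_inv hz)).const_mul s).congr_deriv (by ring)

lemma mul_sub_inv_eq_iff (hs : s ≠ 0) (hz₁ : z₁ ≠ 0) (hz₂ : z₂ ≠ 0) :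
    s * (z₁ - z₁⁻¹) = s * (z₂ - z₂⁻¹) ↔ z₁ = z₂ ∨ z₁ * z₂ = -1 := by
  rw [mul_right_inj' hs, ← sub_eq_zero, ← sub_eq_zero (a := z₁), ← sub_eq_zero (b := (-1 : ℂ)),
    ← mul_eq_zero, show z₁ - z₁⁻¹ - (z₂ - z₂⁻¹) = (z₁ - z₂) * (z₁ * z₂ - -1) / (z₁ * z₂) by
      field_simp; ring, div_eq_zero_iff, or_iff_left (mul_ne_zero hz₁ hz₂)]

lemma mul_sub_inv_eq_zero_iff (hs : s ≠ 0) (hz : z ≠ 0) : s * (z - z⁻¹) = 0 ↔ z = 1 ∨ z = -1 := by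
  simpa using mul_sub_inv_eq_iff hs hz one_ne_zero

lemma spinB_eq_pullback (hs : s ≠ 0) (hz₁ : z₁ ≠ 0) (hz₂ : z₂ ≠ 0)
    (hne : s * (z₁ - z₁⁻¹) ≠ s * (z₂ - z₂⁻¹)) :
    spinB z₁ z₂ = s * (1 + (z₁ ^ 2)⁻¹) * (s * (1 + (z₂ ^ 2)⁻¹)) *
      (1 / (s * (z₁ - z₁⁻¹) - s * (z₂ - z₂⁻¹)) ^ 2) := by
  obtain ⟨hsub, hmul⟩ := not_or.mp (mt (mul_sub_inv_eq_iff hs hz₁ hz₂).mpr hne)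
  have hsub : z₁ - z₂ ≠ 0 := sub_ne_zero.mpr hsub
  have hmul : 1 + z₁ * z₂ ≠ 0 := fun h => hmul (by linear_combination h)
  rw [spinB_eq hz₁, show s * (z₁ - z₁⁻¹) - s * (z₂ - z₂⁻¹) =
    s * (z₁ - z₂) * (1 + z₁ * z₂) / (z₁ * z₂) by field_simp; ring]
  field_simp
  ring

lemma yKN_mul_sub_inv (hs : s ≠ 0) (hr : r = 2 * s ∨ r = -(2 * s)) (hz : z ∈ Complex.slitPlane)
    (hre : 0 < ((z + z⁻¹) / 2).re) :
    yKN r (s * (z - z⁻¹)) = 2 * Complex.log z / (s * (z + z⁻¹)) := by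
  have hz₀ := Complex.slitPlane_ne_zero hz
  have hcsqrt {u : ℂ} (hu : u ^ 2 = ((z - z⁻¹) / 2) ^ 2) : csqrt (1 + u ^ 2) = (z + z⁻¹) / 2 := by
    have hsq : 1 + ((z - z⁻¹) / 2) ^ 2 = ((z + z⁻¹) / 2) ^ 2 := by field_simp; ring
    rw [hu, hsq, csqrt, one_div, Complex.sq_cpow_two_inv hre]
  unfold yKN arcsinh
  rcases hr with rfl | rfl
  · rw [show s * (z - z⁻¹) / (2 * s) = (z - z⁻¹) / 2 by field_simp, hcsqrt rfl]
    ring_nf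
  · have hlog := Complex.log_inv z (Complex.mem_slitPlane_iff_arg.mp hz).1
    rw [show s * (z - z⁻¹) / -(2 * s) = -((z - z⁻¹) / 2) by field_simp, hcsqrt (neg_sq _),
      show -((z - z⁻¹) / 2) + (z + z⁻¹) / 2 = z⁻¹ by ring, hlog,
      show -(2 * s) * ((z + z⁻¹) / 2) = -(s * (z + z⁻¹)) by ring, mul_neg, neg_div_neg_eq]

lemma eventually_yKN_mul_sub_inv (hs : s ≠ 0) (hr : r = 2 * s ∨ r = -(2 * s)) :
    ∀ᶠ z in 𝓝 (1 : ℂ), yKN r (s * (z - z⁻¹)) = 2 * Complex.log z / (s * (z + z⁻¹)) := by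
  have hre : ∀ᶠ z in 𝓝 (1 : ℂ), 0 < ((z + z⁻¹) / 2).re := by
    have hc : ContinuousAt (fun z : ℂ => ((z + z⁻¹) / 2).re) 1 :=
      Complex.continuous_re.continuousAt.comp
        ((continuousAt_id.add (continuousAt_inv₀ one_ne_zero)).div_const 2)
    exact hc.eventually (lt_mem_nhds (by norm_num))
  filter_upwards [hre, Complex.isOpen_slitPlane.mem_nhds Complex.one_mem_slitPlane] with z hre hz
    using yKN_mul_sub_inv hs hr hz hre

lemma eventually_yKN_mul_sub_inv_near_ram (hs : s ≠ 0) (hr : r = 2 * s ∨ r = -(2 * s))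
    (hξ : ξ = 1 ∨ ξ = -1) :
    ∀ᶠ z in 𝓝 ξ, yKN r (s * (z - z⁻¹)) = 2 * Complex.log (z / ξ) / (s * (z + z⁻¹)) := by
  rcases hξ with rfl | rfl
  · simpa only [div_one] using eventually_yKN_mul_sub_inv hs hr
  · have hneg : Tendsto (fun z : ℂ => -z) (𝓝 (-1)) (𝓝 1) := by
      simpa only [neg_neg] using (continuous_neg (G := ℂ)).tendsto (-1)
    -- `s ↦ -s`, `z ↦ -z` moves the identity from `1` to `-1`.
    have hr' : r = 2 * -s ∨ r = -(2 * -s) := by simpa only [mul_neg, neg_neg] using hr.symm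
    filter_upwards [hneg.eventually (eventually_yKN_mul_sub_inv (neg_ne_zero.mpr hs) hr')] with z hz
    rw [div_neg, div_one]
    convert hz using 2 <;> rw [inv_neg] <;> ring

lemma eventually_y_dx_eq (hs : s ≠ 0) (hr : r = 2 * s ∨ r = -(2 * s)) (hξ : ξ = 1 ∨ ξ = -1) :
    ∀ᶠ z in 𝓝 ξ, (2 * (Complex.log (1 / z / ξ) + Complex.log ξ) -
        2 * (Complex.log (z / ξ) + Complex.log ξ)) * (s * (1 - 1 / z ^ 2)) =
      (yKN r (-(s * (z - z⁻¹))) - yKN r (s * (z - z⁻¹))) * (s * (z - z⁻¹)) *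
        (s * (1 + (z ^ 2)⁻¹)) := by
  have hξ₀ : ξ ≠ 0 := by rcases hξ with rfl | rfl <;> norm_num
  have hξ_inv : ξ⁻¹ = ξ := by rcases hξ with rfl | rfl <;> norm_num
  have hξ_sq : ξ ^ 2 + 1 ≠ 0 := by rcases hξ with rfl | rfl <;> norm_num
  have hinv : Tendsto (fun z : ℂ => z⁻¹) (𝓝 ξ) (𝓝 ξ) := by
    simpa only [ContinuousAt, hξ_inv] using continuousAt_inv₀ hξ₀
  have hsq : ContinuousAt (fun z : ℂ => z ^ 2 + 1) ξ := by fun_prop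
  have hy := eventually_yKN_mul_sub_inv_near_ram hs hr hξ
  filter_upwards [hy, hinv.eventually hy, isOpen_ne.mem_nhds hξ₀, hsq.eventually_ne hξ_sq]
    with z hyz hyσ (hz : z ≠ 0) hz_sq
  rw [inv_inv] at hyσ
  rw [hyz, show -(s * (z - z⁻¹)) = s * (z⁻¹ - z) by ring, hyσ, add_comm z⁻¹, one_div]
  field_simp
  ring

theorem curveSpin_isPullback (hε : ε ≠ 0) (hs : s ^ 2 = ε / 2) (hr : r ^ 2 = 2 * ε) :
    (curveSpin ε s hε hs).IsPullback (curveKN ε r hε hr).toRecursionData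
      (fun t => s * (t - t⁻¹)) {z | z ≠ 0} 2 := by
  have hs₀ := ne_zero_of_sq_eq_half hε hs
  have hram {ξ : ℂ} (hξ : ξ ∈ (curveSpin ε s hε hs).ram) : ξ = 1 ∨ ξ = -1 := by
    simpa [curveSpin] using hξ
  have hram₀ {ξ : ℂ} (hξ : ξ ∈ (curveSpin ε s hε hs).ram) : ξ ≠ 0 := by
    rcases hram hξ with rfl | rfl <;> norm_num
  refine
    { isOpen := isOpen_ne
      differentiableOn := fun z hz =>
        (hasDerivAt_mul_sub_inv s hz).differentiableAt.differentiableWithinAt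
      mapsTo := fun _ _ => Set.mem_univ _
      ram_subset := fun _ hξ => hram₀ hξ
      map_mem_ram_iff := fun z hz => ?_
      deriv_ne_zero := fun ξ hξ => ?_
      card_fiber := fun ζ hζ => ?_
      map_σ := fun ξ _ => ?_
      y_dx_eq := fun ξ hξ => ?_
      B_eq := fun z₁ hz₁ z₂ hz₂ hne => ?_ }
  · simpa [curveKN, curveSpin] using mul_sub_inv_eq_zero_iff hs₀ hz
  · rw [(hasDerivAt_mul_sub_inv s (hram₀ hξ)).deriv]
    refine mul_ne_zero hs₀ ?_
    rcases hram hξ with rfl | rfl <;> norm_num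
  · obtain rfl : ζ = 0 := by simpa [curveKN] using hζ
    rw [Finset.filter_true_of_mem fun ξ hξ =>
      (mul_sub_inv_eq_zero_iff hs₀ (hram₀ hξ)).mpr (hram hξ)]
    exact Finset.card_pair (by norm_num)
  · refine Eventually.of_forall fun z => ?_
    simp only [curveSpin, curveKN, one_div, inv_inv]
    ring
  · filter_upwards [eventually_y_dx_eq hs₀ (eq_two_mul_or_eq_neg_two_mul hs hr) (hram hξ),
      isOpen_ne.mem_nhds (hram₀ hξ)] with z hy hz
    simp only [curveSpin, curveKN]
    rw [(hasDerivAt_mul_sub_inv s hz).deriv, (deriv_spin_x s hz).deriv]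
    simpa using hy
  · rw [(hasDerivAt_mul_sub_inv s hz₁).deriv, (hasDerivAt_mul_sub_inv s hz₂).deriv]
    exact spinB_eq_pullback hs₀ hz₁ hz₂ hne

lemma eventually_omega01_eq (hε : ε ≠ 0) (hs : s ^ 2 = ε / 2) (hr : r ^ 2 = 2 * ε) :
    ∀ᶠ z in 𝓝 (1 : ℂ), 2⁻¹ * ((curveKN ε r hε hr).omega01 0 (s * (z - z⁻¹)) *
      deriv (fun t : ℂ => s * (t - t⁻¹)) z) = (curveSpin ε s hε hs).omega01 1 z := by
  have hs₀ := ne_zero_of_sq_eq_half hε hs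
  have hsq : ContinuousAt (fun z : ℂ => z ^ 2 + 1) 1 := by fun_prop
  filter_upwards [eventually_yKN_mul_sub_inv hs₀ (eq_two_mul_or_eq_neg_two_mul hs hr),
    isOpen_ne.mem_nhds one_ne_zero, hsq.eventually_ne (y := 0) (by norm_num)]
    with z hy (hz : z ≠ 0) hz_sq
  have hx : deriv (fun w : ℂ => w ^ 2 / 2) (s * (z - z⁻¹)) = s * (z - z⁻¹) := by simp
  simp only [SpectralCurve.omega01, EquivariantSpectralCurve.omega01, curveKN, curveSpin]
  rw [hy, hx, (hasDerivAt_mul_sub_inv s hz).deriv, (deriv_spin_x s hz).deriv, div_one,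
    Complex.log_one, add_zero, Fintype.card_units_int, Nat.cast_ofNat]
  field_simp

end SpinCover

end TopRec

end

theorem mainTheorem7 (ε s r : ℂ) (hε : ε ≠ 0) (hs : s ^ 2 = ε / 2) (hr : r ^ 2 = 2 * ε) :
    -- the stable range `2g - 2 + n > 0`
    (∀ g n : ℕ, 1 ≤ n → 2 < 2 * g + n → ∀ z : Fin n → ℂ, (∀ i, z i ≠ 0 ∧ z i ≠ 1 ∧ z i ≠ -1) →
      (2 : ℂ) ^ (2 * (g : ℤ) - 2 + n) *
          ((TopRec.curveKN ε r hε hr).omega g n (fun i => s * (z i - (z i)⁻¹)) *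
            ∏ i, deriv (fun t : ℂ => s * (t - t⁻¹)) (z i)) =
        (TopRec.curveSpin ε s hε hs).omega g n z) ∧
    -- `(g, n) = (0, 2)`, away from the poles `z₁ = z₂` and `z₁ = -1/z₂`
    (∀ z : Fin 2 → ℂ, (∀ i, z i ≠ 0) → z 0 ≠ z 1 → z 0 * z 1 ≠ -1 →
      (2 : ℂ) ^ (2 * ((0 : ℕ) : ℤ) - 2 + (2 : ℕ)) *
          ((TopRec.curveKN ε r hε hr).omega 0 2 (fun i => s * (z i - (z i)⁻¹)) *
            ∏ i, deriv (fun t : ℂ => s * (t - t⁻¹)) (z i)) =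
        (TopRec.curveSpin ε s hε hs).omega 0 2 z) ∧
    -- `(g, n) = (0, 1)`, in the branches near `w = 0` and `z = 1`
    (∀ᶠ z in nhds (1 : ℂ),
      (2 : ℂ) ^ (2 * ((0 : ℕ) : ℤ) - 2 + (1 : ℕ)) *
          ((TopRec.curveKN ε r hε hr).omega01 0 (s * (z - z⁻¹)) *
            deriv (fun t : ℂ => s * (t - t⁻¹)) z) =
        (TopRec.curveSpin ε s hε hs).omega01 1 z) := by
  have hs₀ := TopRec.ne_zero_of_sq_eq_half hε hs
  have hcover := TopRec.curveSpin_isPullback hε hs hr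
  refine ⟨fun g n hn hgn z hz => ?_, fun z hz hne hne' => ?_, ?_⟩
  · refine (hcover.omega_eq (E := TopRec.curveKN ε r hε hr) hn hgn fun i => ⟨(hz i).1, ?_⟩).symm
    simpa [TopRec.curveSpin] using (hz i).2
  · have hφ_ne := mt (TopRec.mul_sub_inv_eq_iff hs₀ (hz 0) (hz 1)).mp (not_or.mpr ⟨hne, hne'⟩)
    simpa using (hcover.omega_zero_two_eq hz hφ_ne).symm
  · simpa using TopRec.eventually_omega01_eq hε hs hr
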